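/- Let $n\ge 1$ and let $K\subset\mathbb{R}^{n+1}$ be a compact convex set with the origin in its interior whose boundary $\mathcal{M}^n=\partial K$ is a $C^\infty$ hypersurface with strictly positive Gauss curvature. For $p\in\mathcal{M}^n$ let $\nu(p)$ be the outer unit normal of $K$ at $p$, let $\mathcal{K}(p)=\det(d\nu_p : T_p\mathcal{M}^n\to T_p\mathcal{M}^n)$ be the Gauss curvature of $\mathcal{M}^n$ at $p$, and let $h(x)=\max_{q\in K}\langle q,x\rangle$ be the support function of $K$. If $\mathcal{K}=h$, that is, if $\mathcal{K}(p)=h(\nu(p))$ for every $p\in\mathcal{M}^n$, then $\mathcal{M}^n$ is the origin-centred unit sphere $\{x\in\mathbb{R}^{n+1} : |x|=1\}$. -/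

import Mathlib

open scoped ContDiff InnerProductSpace

noncomputable section

/-- `M` is a smooth (embedded) hypersurface of `E`: near each of its points it is the zero set of
a `C^∞` function whose differential at that point does not vanish. -/
def IsSmoothHypersurface {E : Type*} [NormedAddCommGroup E] [InnerProductSpace ℝ E]
    (M : Set E) : Prop :=
  ∀ p ∈ M, ∃ (U : Set E) (ρ : E → ℝ), IsOpen U ∧ p ∈ U ∧ ContDiffOn ℝ ∞ ρ U ∧
    (∀ q ∈ U, q ∈ M ↔ ρ q = 0) ∧ fderiv ℝ ρ p ≠ 0

/-- `v` is an outer unit normal vector of the convex set `K` at `p`. -/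
def IsOuterUnitNormal {E : Type*} [NormedAddCommGroup E] [InnerProductSpace ℝ E]
    (K : Set E) (p v : E) : Prop :=
  ‖v‖ = 1 ∧ ∀ q ∈ K, ⟪q - p, v⟫_ℝ ≤ 0

/-- The Gauss map of the boundary of a convex set `K`: it takes `p` to the outer unit normal vector
of `K` at `p`, which exists and is unique at every point `p` of the boundary if `K` is a convex body
with smooth boundary. -/
def gaussMap {E : Type*} [NormedAddCommGroup E] [InnerProductSpace ℝ E] (K : Set E) (p : E) : E :=
  Classical.epsilon (IsOuterUnitNormal K p)

/-- The tangent space at `p` of the boundary of `K`, the orthogonal complement of the normal. -/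
abbrev tangentHyperplane {E : Type*} [NormedAddCommGroup E] [InnerProductSpace ℝ E]
    (K : Set E) (p : E) : Submodule ℝ E :=
  (ℝ ∙ gaussMap K p)ᗮ

/-- The shape operator (Weingarten map) at `p` of the boundary of `K` with respect to the outer
unit normal: the differential at `p` of the Gauss map along the boundary, as an endomorphism of the
tangent space. Along a smooth boundary this differential is determined on tangent vectors and takes
tangent values, so that the orthogonal projection only serves to fix the codomain. -/
def shapeOperator {E : Type*} [NormedAddCommGroup E] [InnerProductSpace ℝ E]
    (K : Set E) (p : E) : tangentHyperplane K p →L[ℝ] tangentHyperplane K p :=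
  (tangentHyperplane K p).orthogonalProjectionOnto ∘L
    fderivWithin ℝ (gaussMap K) (frontier K) p ∘L (tangentHyperplane K p).subtypeL

/-- The Gauss curvature at `p` of the boundary of `K`: the determinant of the shape operator, that
is, the product of the principal curvatures. -/
def gaussCurvature {E : Type*} [NormedAddCommGroup E] [InnerProductSpace ℝ E]
    (K : Set E) (p : E) : ℝ :=
  LinearMap.det (shapeOperator K p : tangentHyperplane K p →ₗ[ℝ] tangentHyperplane K p)

/-- The support function `x ↦ sup_{q ∈ K} ⟨q, x⟩` of `K`. -/
def supportFunction {E : Type*} [NormedAddCommGroup E] [InnerProductSpace ℝ E]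
    (K : Set E) (x : E) : ℝ :=
  sSup ((fun q => ⟪q, x⟫_ℝ) '' K)

/-- The boundary of `K` is a closed, smooth, strictly convex hypersurface with the origin inside:
`K` is a compact convex set with the origin in its interior, and its boundary is a smooth
hypersurface of strictly positive Gauss curvature. -/
structure BoundsSmoothStrictlyConvexHypersurface {E : Type*} [NormedAddCommGroup E]
    [InnerProductSpace ℝ E] (K : Set E) : Prop where
  convex : Convex ℝ K
  isCompact : IsCompact K
  zero_mem_interior : (0 : E) ∈ interior K
  smooth : IsSmoothHypersurface (frontier K)
  gaussCurvature_pos : ∀ p ∈ frontier K, 0 < gaussCurvature K p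

end

open MeasureTheory Set Filter Topology
open scoped ENNReal Pointwise

/-! ### The Brunn–Minkowski inequality -/

/-! Let d = dim E, let X be the inverse Gauss map extended with degree zero (`inverseGaussMap`), and
h(u) = ⟪X u, u⟫. Since the differentials of the Gauss map and of X are inverse to each other on
tangent spaces, the hypothesis becomes h · det dX = 1: the cone volume measure of K is the surface
measure of the unit sphere. Equivalently, Φ(x) = ‖x‖ X(x) has Jacobian one (`det_fderiv_cone`), so
the star body with radial function R and its image under Φ both have volume (1/d) ∫ R^d.

Fix a unit vector e and choose c so that φ = ⟪X, e⟫ - c has mean zero on the sphere. The Φ-images of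
the star bodies with radial functions 1/(1 ∓ tφ) have, to second order in t, support functions at
most h(1 ± tφ + t²(φ² + h⟪dX e, e⟫/2)). Midpoints of their points therefore lie, up to an
arbitrarily small t² error, in the Φ-image for the radial function 1 + t²(φ² + h⟪dX e, e⟫/2). The
Brunn–Minkowski inequality, obtained here from Prékopa–Leindler, compares the volumes, and its t²
coefficient is (d - 1) ∫ φ² ≤ ∫ h⟪dX e, e⟫ (`local_brunnMinkowski`).

Let a be the mean of X. Sum this over an orthonormal basis, c being the corresponding coordinate of
a, and integrate by parts on the sphere (`sphereIntegral_fderiv`): the squared L² norm of the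
tangential part of X - a is at most zero. Hence it vanishes (`exists_eq_add_smul`), which for d ≥ 2
makes the hypersurface a round sphere centred at a. The determinant condition at u and -u then gives
a = 0 and radius one (`eq_self_of_eq_add_smul`).

What remains is regularity: X is well defined and C^1 because positive curvature lets the inverse
function theorem invert an extension of the Gauss map (`exists_local_inverse_gaussMap`). -/

theorem volume_add_le_two_mul_of_midpoint_mem {A B C : Set ℝ} (hA : MeasurableSet A)
    (hB : MeasurableSet B) (hA0 : A.Nonempty) (hB0 : B.Nonempty)
    (h : ∀ a ∈ A, ∀ b ∈ B, (1 / 2 : ℝ) * (a + b) ∈ C) :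
    volume A + volume B ≤ 2 * volume C := by
  have key : ∀ K ⊆ A, IsCompact K → K.Nonempty → ∀ L ⊆ B, IsCompact L → L.Nonempty →
      volume K + volume L ≤ 2 * volume C := by
    intro K hKA hK hK0 L hLB hL hL0
    set k := sSup K
    set l := sInf L
    have hkK : k ∈ K := hK.sSup_mem hK0
    have hlL : l ∈ L := hL.sInf_mem hL0
    have h1 : volume ((fun x => l + x) '' K) = volume K := by
      simp [image_add_left, measure_preimage_add]
    have h2 : volume ((fun x => k + x) '' L) = volume L := by
      simp [image_add_left, measure_preimage_add]
    -- With k = max K and l = min L, the translates l + K and k + L lie on either side of k + l, and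
    -- both are contained in 2C, so their volumes add up.
    have hinter : ((fun x => l + x) '' K) ∩ ((fun x => k + x) '' L) ⊆ {k + l} := by
      rintro _ ⟨⟨x, hx, rfl⟩, ⟨y, hy, hxy⟩⟩
      have hx' : x ≤ k := le_csSup hK.bddAbove hx
      have hy' : l ≤ y := csInf_le hL.bddBelow hy
      simp only at hxy
      simp only [mem_singleton_iff]
      linarith
    have hunion : ((fun x => l + x) '' K) ∪ ((fun x => k + x) '' L) ⊆
        (2 : ℝ) • C := by
      rintro _ (⟨x, hx, rfl⟩ | ⟨y, hy, rfl⟩)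
      · exact ⟨_, h x (hKA hx) l (hLB hlL), by simp only [smul_eq_mul]; ring⟩
      · exact ⟨_, h k (hKA hkK) y (hLB hy), by simp only [smul_eq_mul]; ring⟩
    have hmeas : MeasurableSet ((fun x => k + x) '' L) :=
      (hL.image (by fun_prop)).measurableSet
    have hsc : volume ((2 : ℝ) • C) = 2 * volume C := by
      simp
    calc volume K + volume L
        = volume ((fun x => l + x) '' K) + volume ((fun x => k + x) '' L) := by rw [h1, h2]
      _ = volume (((fun x => l + x) '' K) ∪ ((fun x => k + x) '' L)) := by
          rw [measure_union₀ hmeas.nullMeasurableSet]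
          exact measure_mono_null hinter (by simp)
      _ ≤ 2 * volume C := hsc ▸ measure_mono hunion
  have hsup : ∀ {S : Set ℝ}, MeasurableSet S → ∀ s ∈ S, volume S =
      ⨆ K : {K : Set ℝ // K ⊆ S ∧ IsCompact K ∧ K.Nonempty}, volume K.1 := by
    intro S hS s hs
    refine le_antisymm ?_ (iSup_le fun K => measure_mono K.2.1)
    rw [hS.measure_eq_iSup_isCompact]
    refine iSup_le fun K => iSup_le fun hKS => iSup_le fun hK => ?_
    exact (measure_mono (subset_insert s K)).trans (le_iSup (fun K : {K : Set ℝ // K ⊆ S ∧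
      IsCompact K ∧ K.Nonempty} => volume K.1)
      ⟨insert s K, insert_subset hs hKS, hK.insert s, insert_nonempty s K⟩)
  obtain ⟨a, ha⟩ := hA0
  obtain ⟨b, hb⟩ := hB0
  rw [hsup hA a ha, hsup hB b hb]
  have : Nonempty {K : Set ℝ // K ⊆ A ∧ IsCompact K ∧ K.Nonempty} :=
    ⟨{a}, singleton_subset_iff.2 ha, isCompact_singleton, singleton_nonempty a⟩
  have : Nonempty {K : Set ℝ // K ⊆ B ∧ IsCompact K ∧ K.Nonempty} :=
    ⟨{b}, singleton_subset_iff.2 hb, isCompact_singleton, singleton_nonempty b⟩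
  exact ENNReal.iSup_add_iSup_le fun K L =>
    key K.1 K.2.1 K.2.2.1 K.2.2.2 L.1 L.2.1 L.2.2.1 L.2.2.2

theorem four_mul_mul_le_add_sq (a b : ℝ≥0∞) : 4 * (a * b) ≤ (a + b) ^ 2 := by
  rcases eq_or_ne a ⊤ with rfl | ha
  · simp
  rcases eq_or_ne b ⊤ with rfl | hb
  · simp
  lift a to NNReal using ha
  lift b to NNReal using hb
  have := four_mul_le_sq_add a b
  rw [← mul_assoc]
  exact_mod_cast this

/-- For t < 1 the superlevel sets of f and g are nonempty because both suprema are one, and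
midpoints of their points lie in the superlevel set of h. The inequality for sets is then integrated
over t by the layer-cake formula. -/
theorem lintegral_add_le_of_iSup_eq_one {f g h : ℝ → ℝ≥0∞} (hf : Measurable f)
    (hg : Measurable g) (hh : Measurable h) (hf1 : ⨆ x, f x = 1) (hg1 : ⨆ x, g x = 1)
    (H : ∀ x y, f x * g y ≤ h ((1 / 2 : ℝ) * (x + y)) ^ 2) :
    (∫⁻ x, f x) + ∫⁻ x, g x ≤ 2 * ∫⁻ x, h x := by
  have lc : ∀ u : ℝ → ℝ≥0∞, Measurable u → (∀ x, u x ≤ 1) →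
      ∫⁻ x, u x = ∫⁻ t in Ioi (0 : ℝ), volume {x | ENNReal.ofReal t < u x} := by
    intro u hu hu1
    have hfin : ∀ x, u x ≠ ⊤ := fun x => ne_top_of_le_ne_top ENNReal.one_ne_top (hu1 x)
    have := lintegral_eq_lintegral_meas_lt (volume : Measure ℝ) (f := fun x => (u x).toReal)
      (Eventually.of_forall fun x => ENNReal.toReal_nonneg) hu.ennreal_toReal.aemeasurable
    simp only [ENNReal.ofReal_toReal (hfin _)] at this
    rw [this]
    refine setLIntegral_congr_fun measurableSet_Ioi fun t ht => ?_
    simp only [ENNReal.ofReal_lt_iff_lt_toReal (le_of_lt ht) (hfin _)]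
  have hfle : ∀ x, f x ≤ 1 := fun x => hf1 ▸ le_iSup f x
  have hgle : ∀ x, g x ≤ 1 := fun x => hg1 ▸ le_iSup g x
  -- Truncation at one preserves the hypothesis, as f and g are at most one, and makes `lc`
  -- applicable.
  set h' : ℝ → ℝ≥0∞ := fun x => min (h x) 1
  have hh' : Measurable h' := hh.min measurable_const
  have H' : ∀ x y, f x * g y ≤ h' ((1 / 2 : ℝ) * (x + y)) ^ 2 := by
    intro x y
    rcases le_total (h ((1 / 2 : ℝ) * (x + y))) 1 with h1 | h1
    · simp only [h', min_eq_left h1]; exact H x y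
    · simp only [h', min_eq_right h1, one_pow]; exact mul_le_one' (hfle x) (hgle y)
  calc (∫⁻ x, f x) + ∫⁻ x, g x
      = ∫⁻ t in Ioi (0 : ℝ), (volume {x | ENNReal.ofReal t < f x} +
          volume {x | ENNReal.ofReal t < g x}) := by
        rw [lc f hf hfle, lc g hg hgle, lintegral_add_left']
        refine Measurable.aemeasurable (Antitone.measurable fun s t hst => ?_)
        exact measure_mono fun x hx => (ENNReal.ofReal_le_ofReal hst).trans_lt hx
    _ ≤ ∫⁻ t in Ioi (0 : ℝ), 2 * volume {x | ENNReal.ofReal t < h' x} := by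
        refine setLIntegral_mono' measurableSet_Ioi fun t ht => ?_
        rcases lt_or_ge t 1 with h1 | h1
        · have h1' : ENNReal.ofReal t < 1 := by
            rw [← ENNReal.ofReal_one]; exact (ENNReal.ofReal_lt_ofReal_iff one_pos).2 h1
          refine volume_add_le_two_mul_of_midpoint_mem (measurableSet_lt measurable_const hf)
            (measurableSet_lt measurable_const hg) ?_ ?_ ?_
          · exact lt_iSup_iff.1 (hf1 ▸ h1')
          · exact lt_iSup_iff.1 (hg1 ▸ h1')
          · intro a ha b hb
            have h3 : ENNReal.ofReal t ^ 2 < h' ((1 / 2 : ℝ) * (a + b)) ^ 2 := by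
              refine lt_of_lt_of_le ?_ (H' a b)
              rw [sq]
              exact ENNReal.mul_lt_mul ha hb
            exact lt_of_not_ge fun hle => h3.not_ge (pow_le_pow_left' hle 2)
        · have h1' : 1 ≤ ENNReal.ofReal t := by simpa using ENNReal.ofReal_le_ofReal h1
          have e1 : {x | ENNReal.ofReal t < f x} = ∅ :=
            eq_empty_of_forall_notMem fun x hx => absurd ((hfle x).trans h1') (not_le.2 hx)
          have e2 : {x | ENNReal.ofReal t < g x} = ∅ :=
            eq_empty_of_forall_notMem fun x hx => absurd ((hgle x).trans h1') (not_le.2 hx)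
          simp [e1, e2]
    _ = 2 * ∫⁻ x, h' x := by
        rw [lc h' hh' fun x => min_le_right _ _, lintegral_const_mul]
        refine Antitone.measurable fun s t hst => ?_
        exact measure_mono fun x hx => (ENNReal.ofReal_le_ofReal hst).trans_lt hx
    _ ≤ 2 * ∫⁻ x, h x := by gcongr; exact min_le_left _ _

/-- Divide f and g by their suprema and h by the geometric mean of these; the arithmetic-geometric
mean inequality turns the additive bound into the multiplicative one. -/
theorem prekopaLeindler_real_of_iSup_ne_top {f g h : ℝ → ℝ≥0∞} (hf : Measurable f)
    (hg : Measurable g) (hh : Measurable h) (hf1 : ⨆ x, f x ≠ ⊤) (hg1 : ⨆ x, g x ≠ ⊤)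
    (H : ∀ x y, f x * g y ≤ h ((1 / 2 : ℝ) * (x + y)) ^ 2) :
    (∫⁻ x, f x) * ∫⁻ x, g x ≤ (∫⁻ x, h x) ^ 2 := by
  set F := ⨆ x, f x with hF
  set G := ⨆ x, g x with hG
  rcases eq_or_ne F 0 with hF0 | hF0
  · have : ∀ x, f x = 0 := by simpa using iSup_eq_bot.1 (hF.symm.trans hF0)
    simp [this]
  rcases eq_or_ne G 0 with hG0 | hG0
  · have : ∀ x, g x = 0 := by simpa using iSup_eq_bot.1 (hG.symm.trans hG0)
    simp [this]
  set c : ℝ≥0∞ := (F⁻¹ * G⁻¹) ^ (1 / 2 : ℝ) with hc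
  have hc2 : c ^ 2 = F⁻¹ * G⁻¹ := by
    rw [hc, ← ENNReal.rpow_natCast, ← ENNReal.rpow_mul]
    norm_num
  have h1 := lintegral_add_le_of_iSup_eq_one (f := fun x => F⁻¹ * f x) (g := fun x => G⁻¹ * g x)
    (h := fun x => c * h x) (hf.const_mul _) (hg.const_mul _) (hh.const_mul _)
    (by rw [← ENNReal.mul_iSup, ← hF, ENNReal.inv_mul_cancel hF0 hf1])
    (by rw [← ENNReal.mul_iSup, ← hG, ENNReal.inv_mul_cancel hG0 hg1])
    (fun x y => by
      rw [mul_pow, hc2, mul_mul_mul_comm]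
      gcongr
      exact H x y)
  rw [lintegral_const_mul _ hf, lintegral_const_mul _ hg, lintegral_const_mul _ hh] at h1
  have h2 := (four_mul_mul_le_add_sq _ _).trans (pow_le_pow_left' h1 2)
  have h3 : 4 * (F⁻¹ * (∫⁻ x, f x) * (G⁻¹ * ∫⁻ x, g x)) =
      (4 * (F⁻¹ * G⁻¹)) * ((∫⁻ x, f x) * ∫⁻ x, g x) := by ring
  have h4 : (2 * (c * ∫⁻ x, h x)) ^ 2 = (4 * (F⁻¹ * G⁻¹)) * (∫⁻ x, h x) ^ 2 := by
    rw [← hc2]; ring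
  rw [h3, h4] at h2
  refine (ENNReal.mul_le_mul_iff_right ?_ ?_).1 h2
  · simp [hf1, hg1]
  · exact ENNReal.mul_ne_top (by simp) (ENNReal.mul_ne_top (by simpa) (by simpa))

theorem prekopaLeindler_real {f g h : ℝ → ℝ≥0∞} (hf : Measurable f)
    (hg : Measurable g) (hh : Measurable h)
    (H : ∀ x y, f x * g y ≤ h ((1 / 2 : ℝ) * (x + y)) ^ 2) :
    (∫⁻ x, f x) * ∫⁻ x, g x ≤ (∫⁻ x, h x) ^ 2 := by
  have trunc : ∀ u : ℝ → ℝ≥0∞, Measurable u →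
      ∫⁻ x, u x = ⨆ k : ℕ, ∫⁻ x, min (u x) k := by
    intro u hu
    rw [← lintegral_iSup (fun k => hu.min measurable_const)]
    · congr 1 with x
      rw [← inf_iSup_eq, ENNReal.iSup_natCast, inf_top_eq]
    · intro k l hkl x
      exact min_le_min le_rfl (by exact_mod_cast hkl)
  rw [trunc f hf, trunc g hg, ENNReal.iSup_mul]
  refine iSup_le fun k => ?_
  rw [ENNReal.mul_iSup]
  refine iSup_le fun l => prekopaLeindler_real_of_iSup_ne_top (hf.min measurable_const)
    (hg.min measurable_const) hh ?_ ?_ fun x y => ?_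
  · exact ne_top_of_le_ne_top (ENNReal.natCast_ne_top k) (iSup_le fun x => min_le_right _ _)
  · exact ne_top_of_le_ne_top (ENNReal.natCast_ne_top l) (iSup_le fun x => min_le_right _ _)
  · exact (mul_le_mul' (min_le_left _ _) (min_le_left _ _)).trans (H x y)

theorem lintegral_fin_succ_pi {n : ℕ} {f : (Fin (n + 1) → ℝ) → ℝ≥0∞} (hf : Measurable f) :
    ∫⁻ x, f x = ∫⁻ s : ℝ, ∫⁻ y : Fin n → ℝ, f (Fin.cons s y) := by
  have hmp := (volume_preserving_piFinSuccAbove (fun _ : Fin (n + 1) => ℝ) 0).symm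
  rw [← hmp.lintegral_comp hf, Measure.volume_eq_prod]
  refine (lintegral_prod _ (hf.comp hmp.measurable).aemeasurable).trans ?_
  simp [MeasurableEquiv.piFinSuccAbove, Fin.insertNthEquiv]

/-- Induction by Tonelli: the inequality in dimension n says that the integrals over slices satisfy
the hypothesis of the one-dimensional inequality. -/
theorem prekopaLeindler_pi (n : ℕ) : ∀ {f g h : (Fin n → ℝ) → ℝ≥0∞}, Measurable f →
    Measurable g → Measurable h →
    (∀ x y, f x * g y ≤ h ((1 / 2 : ℝ) • (x + y)) ^ 2) →
    (∫⁻ x, f x) * ∫⁻ x, g x ≤ (∫⁻ x, h x) ^ 2 := by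
  induction n with
  | zero =>
    intro f g h _ _ _ H
    have h2 : (volume : Measure (Fin 0 → ℝ)) univ = 1 := by simp [volume_pi]
    simp only [lintegral_unique, h2, mul_one]
    refine (H _ _).trans_eq ?_
    congr 2
    exact Subsingleton.elim _ _
  | succ n ih =>
    intro f g h hf hg hh H
    have hcons : Measurable fun p : ℝ × (Fin n → ℝ) => (Fin.cons p.1 p.2 : Fin (n + 1) → ℝ) := by
      refine measurable_pi_iff.2 fun i => ?_
      refine Fin.cases ?_ (fun j => ?_) i
      · simpa using measurable_fst
      · simp only [Fin.cons_succ]; fun_prop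
    rw [lintegral_fin_succ_pi hf, lintegral_fin_succ_pi hg, lintegral_fin_succ_pi hh]
    refine prekopaLeindler_real (hf.comp hcons).lintegral_prod_right'
      (hg.comp hcons).lintegral_prod_right' (hh.comp hcons).lintegral_prod_right' fun s t => ?_
    have hcs : ∀ s : ℝ, Measurable fun y : Fin n → ℝ => (Fin.cons s y : Fin (n + 1) → ℝ) :=
      fun s => hcons.comp measurable_prodMk_left
    refine ih (hf.comp (hcs s)) (hg.comp (hcs t)) (hh.comp (hcs _)) fun x y => ?_
    refine (H _ _).trans_eq ?_
    congr 2
    ext i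
    refine Fin.cases ?_ (fun j => ?_) i <;> simp [mul_add]

/-- Prékopa–Leindler for indicator functions in orthonormal coordinates. The multiplicative form
suffices, since only an expansion to second order will be used. -/
theorem brunnMinkowski_midpoint {E : Type*} [NormedAddCommGroup E] [InnerProductSpace ℝ E]
    [FiniteDimensional ℝ E] [MeasurableSpace E] [BorelSpace E] {A B C : Set E}
    (hA : MeasurableSet A) (hB : MeasurableSet B) (hC : MeasurableSet C)
    (H : ∀ a ∈ A, ∀ b ∈ B, (1 / 2 : ℝ) • (a + b) ∈ C) :
    volume A * volume B ≤ volume C ^ 2 := by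
  set b := stdOrthonormalBasis ℝ E
  have hmp : MeasurePreserving (fun x : E => WithLp.ofLp (b.repr x)) volume volume :=
    (PiLp.volume_preserving_ofLp _).comp b.measurePreserving_repr
  set e : E ≃ᵐ (Fin (Module.finrank ℝ E) → ℝ) :=
    b.measurableEquiv.trans (MeasurableEquiv.toLp 2 _).symm with he
  have hmp' : MeasurePreserving e volume volume := hmp
  have hadd : ∀ x y, e.symm ((1 / 2 : ℝ) • (x + y)) = (1 / 2 : ℝ) • (e.symm x + e.symm y) := by
    intro x y
    apply e.injective
    have hlin : ∀ u v : E, e ((1 / 2 : ℝ) • (u + v)) = (1 / 2 : ℝ) • (e u + e v) := by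
      intro u v
      change WithLp.ofLp (b.repr _) = (1 / 2 : ℝ) • (WithLp.ofLp (b.repr u) +
        WithLp.ofLp (b.repr v))
      simp
    rw [hlin]
    simp only [MeasurableEquiv.apply_symm_apply]
  have hvol : ∀ S : Set E, MeasurableSet S →
      volume S = ∫⁻ x, S.indicator (fun _ => (1 : ℝ≥0∞)) (e.symm x) := by
    intro S hS
    rw [hmp'.symm.lintegral_comp (measurable_const.indicator hS), lintegral_indicator_const hS]
    simp
  rw [hvol A hA, hvol B hB, hvol C hC]
  refine prekopaLeindler_pi _ ((measurable_const.indicator hA).comp e.symm.measurable)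
    ((measurable_const.indicator hB).comp e.symm.measurable)
    ((measurable_const.indicator hC).comp e.symm.measurable) fun x y => ?_
  by_cases hx : e.symm x ∈ A
  · by_cases hy : e.symm y ∈ B
    · have := H _ hx _ hy
      rw [← hadd] at this
      simp only [indicator_of_mem hx, indicator_of_mem hy, indicator_of_mem this]
      simp
    · simp [hy]
  · simp [hx]

open Metric Module

/-! ### Integration over the unit sphere -/

theorem continuousOn_normalize_comp {E : Type*} [NormedAddCommGroup E] [InnerProductSpace ℝ E]
    {R : E → ℝ} (hR : ContinuousOn R (sphere 0 1)) :
    ContinuousOn (fun x : E => R (‖x‖⁻¹ • x)) {0}ᶜ := by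
  refine hR.comp ?_ fun x hx => ?_
  · exact (continuous_norm.continuousOn.inv₀ fun x hx => norm_ne_zero_iff.2 hx).smul
      continuousOn_id
  · have : ‖x‖ ≠ 0 := norm_ne_zero_iff.2 hx
    simp [norm_smul, this]

theorem hasFDerivAt_norm_of_ne_zero {E : Type*} [NormedAddCommGroup E] [InnerProductSpace ℝ E]
    {x : E} (hx : x ≠ 0) : HasFDerivAt (fun x : E => ‖x‖) (‖x‖⁻¹ • innerSL ℝ x) x := by
  have h := (hasStrictFDerivAt_norm_sq x).hasFDerivAt.sqrt (by simpa using hx)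
  simp only [Real.sqrt_sq (norm_nonneg _)] at h
  convert h using 1
  ext y
  have : ‖x‖ ≠ 0 := norm_ne_zero_iff.2 hx
  simp
  field_simp

theorem fderiv_smul_eq_of_homogeneous {E F : Type*} [NormedAddCommGroup E] [NormedSpace ℝ E]
    [NormedAddCommGroup F] [NormedSpace ℝ F]
    {g : E → F} (hg : ∀ c > (0 : ℝ), ∀ x, g (c • x) = c • g x)
    {c : ℝ} (hc : 0 < c) (x : E) : fderiv ℝ g (c • x) = fderiv ℝ g x := by
  have h1 : (fun x => g (c • x)) = fun x => c • g x := funext fun x => hg c hc x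
  have h2 : fderiv ℝ (fun x => g (c • x)) x = c • fderiv ℝ g (c • x) := fderiv_comp_smul c
  rw [h1, show (fun x => c • g x) = c • g from rfl, fderiv_const_smul_field] at h2
  exact (smul_right_injective _ hc.ne' h2).symm

/-- The open star body with radial function `R`, punctured at the origin. -/
def puncturedStar {E : Type*} [NormedAddCommGroup E] [NormedSpace ℝ E] (R : E → ℝ) : Set E :=
  {x | x ≠ 0 ∧ ‖x‖ < R (‖x‖⁻¹ • x)}

theorem isOpen_puncturedStar {E : Type*} [NormedAddCommGroup E] [InnerProductSpace ℝ E]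
    {R : E → ℝ} (hR : ContinuousOn R (sphere 0 1)) :
    IsOpen (puncturedStar R) := by
  have := ((continuousOn_normalize_comp hR).sub continuous_norm.continuousOn).isOpen_inter_preimage
    isOpen_compl_singleton (isOpen_Ioi (a := (0 : ℝ)))
  convert this using 1
  ext x
  simp [puncturedStar]

noncomputable section SphereIntegral

variable {E : Type*} [NormedAddCommGroup E] [InnerProductSpace ℝ E] [FiniteDimensional ℝ E]
  [MeasurableSpace E] [BorelSpace E]

/-- The integral over the unit sphere, with respect to the surface measure. -/
def sphereIntegral (f : E → ℝ) : ℝ :=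
  ∫ u : sphere (0 : E) 1, f u ∂(volume : Measure E).toSphere

theorem ContinuousOn.integrable_toSphere {f : E → ℝ} (hf : ContinuousOn f (sphere 0 1)) :
    Integrable (fun u : sphere (0 : E) 1 => f u) (volume : Measure E).toSphere := by
  have : Continuous fun u : sphere (0 : E) 1 => f u := continuousOn_iff_continuous_domRestrict.1 hf
  exact this.integrable_of_hasCompactSupport (HasCompactSupport.of_compactSpace _)

theorem sphereIntegral_add {f g : E → ℝ} (hf : ContinuousOn f (sphere 0 1))
    (hg : ContinuousOn g (sphere 0 1)) :
    sphereIntegral (fun u => f u + g u) = sphereIntegral f + sphereIntegral g :=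
  integral_add hf.integrable_toSphere hg.integrable_toSphere

theorem sphereIntegral_sub {f g : E → ℝ} (hf : ContinuousOn f (sphere 0 1))
    (hg : ContinuousOn g (sphere 0 1)) :
    sphereIntegral (fun u => f u - g u) = sphereIntegral f - sphereIntegral g :=
  integral_sub hf.integrable_toSphere hg.integrable_toSphere

theorem sphereIntegral_const_mul (c : ℝ) (f : E → ℝ) :
    sphereIntegral (fun u => c * f u) = c * sphereIntegral f :=
  integral_const_mul c _

theorem sphereIntegral_const (c : ℝ) :
    sphereIntegral (fun _ : E => c) = c * sphereIntegral (fun _ : E => (1 : ℝ)) := by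
  simpa using sphereIntegral_const_mul c (fun _ : E => (1 : ℝ))

theorem sphereIntegral_sum {ι : Type*} (s : Finset ι) {f : ι → E → ℝ}
    (hf : ∀ i ∈ s, ContinuousOn (f i) (sphere 0 1)) :
    sphereIntegral (fun u => ∑ i ∈ s, f i u) = ∑ i ∈ s, sphereIntegral (f i) :=
  integral_finsetSum s fun i hi => (hf i hi).integrable_toSphere

theorem sphereIntegral_mono {f g : E → ℝ} (hf : ContinuousOn f (sphere 0 1))
    (hg : ContinuousOn g (sphere 0 1)) (h : ∀ u : E, ‖u‖ = 1 → f u ≤ g u) :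
    sphereIntegral f ≤ sphereIntegral g :=
  integral_mono hf.integrable_toSphere hg.integrable_toSphere fun u => h u (by simp)

theorem sphereIntegral_congr {f g : E → ℝ} (h : ∀ u : E, ‖u‖ = 1 → f u = g u) :
    sphereIntegral f = sphereIntegral g :=
  integral_congr_ae (Eventually.of_forall fun u => h u (by simp))

theorem sphereIntegral_one_pos [Nontrivial E] :
    0 < sphereIntegral (fun _ : E => (1 : ℝ)) := by
  have : (volume : Measure E).toSphere.real univ ≠ 0 := by
    simp [Measure.real, ENNReal.toReal_eq_zero_iff, Module.finrank_pos.ne',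
      (measure_ball_pos (volume : Measure E) 0 one_pos).ne', measure_ball_lt_top.ne]
  simpa [sphereIntegral] using lt_of_le_of_ne measureReal_nonneg this.symm

theorem eq_zero_of_sphereIntegral_le_zero {f : E → ℝ} (hf : ContinuousOn f (sphere 0 1))
    (h0 : ∀ u : E, ‖u‖ = 1 → 0 ≤ f u) (hI : sphereIntegral f ≤ 0) (u : E) (hu : ‖u‖ = 1) :
    f u = 0 := by
  have hc : Continuous fun u : sphere (0 : E) 1 => f u := continuousOn_iff_continuous_domRestrict.1 hf
  have h0' : 0 ≤ fun u : sphere (0 : E) 1 => f u := fun u => h0 u (by simp)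
  have h1 : ∫ u : sphere (0 : E) 1, f u ∂(volume : Measure E).toSphere = 0 :=
    le_antisymm hI (integral_nonneg h0')
  have h2 := (integral_eq_zero_iff_of_nonneg h0' hf.integrable_toSphere).1 h1
  have h3 := (hc.ae_eq_iff_eq (volume : Measure E).toSphere continuous_const).1 h2
  exact congrFun h3 ⟨u, by simpa using hu⟩

theorem volume_puncturedStar [Nontrivial E] {R : E → ℝ} (hR : ContinuousOn R (sphere 0 1))
    (hR0 : ∀ u : E, ‖u‖ = 1 → 0 < R u) :
    volume (puncturedStar R) =
      ENNReal.ofReal (sphereIntegral (fun u => R u ^ finrank ℝ E) / finrank ℝ E) := by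
  set d := finrank ℝ E
  have hd : 0 < d := Module.finrank_pos
  have hmp := (volume : Measure E).measurePreserving_homeomorphUnitSphereProd
  set T : Set (sphere (0 : E) 1 × Ioi (0 : ℝ)) := {p | p.2.1 < R p.1}
  have hRc : Continuous fun u : sphere (0 : E) 1 => R u :=
    continuousOn_iff_continuous_domRestrict.1 hR
  have hT : MeasurableSet T := by
    exact (isOpen_lt (continuous_subtype_val.comp continuous_snd)
      (hRc.comp continuous_fst)).measurableSet
  have e1 : volume (puncturedStar R) =
      (Measure.comap ((↑) : ({0}ᶜ : Set E) → E) volume) (homeomorphUnitSphereProd E ⁻¹' T) := by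
    rw [comap_subtype_coe_apply (measurableSet_singleton _).compl]
    congr 1
    ext x
    simp only [puncturedStar, mem_ofPred_eq, mem_image, mem_preimage, T, Subtype.exists,
      exists_and_right, exists_eq_right]
    constructor
    · rintro ⟨hx, h⟩
      exact ⟨hx, by simpa using h⟩
    · rintro ⟨hx, h⟩
      exact ⟨hx, by simpa using h⟩
  rw [e1, hmp.measure_preimage hT.nullMeasurableSet, Measure.prod_apply hT]
  have e2 : ∀ u : sphere (0 : E) 1, Measure.volumeIoiPow (d - 1) (Prod.mk u ⁻¹' T) =
      ENNReal.ofReal (R u ^ d / d) := by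
    intro u
    have : Prod.mk u ⁻¹' T = Iio ⟨R u, hR0 u (by simp)⟩ := by
      ext r; simp [T, ← Subtype.coe_lt_coe]
    rw [this, Measure.volumeIoiPow_apply_Iio, Nat.sub_add_cancel hd]
    simp [Nat.cast_sub (show 1 ≤ d from hd)]
  simp only [d] at e2
  simp only [e2]
  rw [← ofReal_integral_eq_lintegral_ofReal, integral_div]
  · rfl
  · exact ((hR.pow _).div_const _).integrable_toSphere
  · exact Eventually.of_forall fun u => by have := hR0 u (by simp); positivity

theorem integral_norm_mul_normalize [Nontrivial E] (w : ℝ → ℝ) (g : E → ℝ) :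
    ∫ x : E, w ‖x‖ * g (‖x‖⁻¹ • x) =
      (∫ r : Ioi (0 : ℝ), w r ∂Measure.volumeIoiPow (finrank ℝ E - 1)) * sphereIntegral g := by
  calc ∫ x : E, w ‖x‖ * g (‖x‖⁻¹ • x)
      = ∫ x : ({0}ᶜ : Set E), w ‖x.1‖ * g (‖x.1‖⁻¹ • x.1) ∂(volume.comap Subtype.val) := by
        rw [integral_subtype_comap (measurableSet_singleton _).compl
          fun x : E => w ‖x‖ * g (‖x‖⁻¹ • x), restrict_compl_singleton]
    _ = ∫ p, g p.1 * w p.2 ∂(volume : Measure E).toSphere.prod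
          (.volumeIoiPow (finrank ℝ E - 1)) := by
        rw [← (volume : Measure E).measurePreserving_homeomorphUnitSphereProd.integral_comp
          (Homeomorph.measurableEmbedding _)]
        simp [mul_comm]
    _ = _ := by
        rw [integral_prod_mul (fun u : sphere (0 : E) 1 => g u) fun r : Ioi (0 : ℝ) => w r,
          mul_comm]
        rfl

theorem integrable_norm_mul_normalize {w : ℝ → ℝ} (hw : Continuous w)
    (hw0 : ∀ x : E, x ∈ ball 0 1 → w ‖x‖ = 0) (hws : HasCompactSupport fun x : E => w ‖x‖)
    {g : E → ℝ} (hg : ContinuousOn g (sphere 0 1)) :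
    Integrable (fun x : E => w ‖x‖ * g (‖x‖⁻¹ • x)) := by
  refine Continuous.integrable_of_hasCompactSupport ?_ hws.mul_right
  rw [continuous_iff_continuousAt]
  intro x
  rcases eq_or_ne x 0 with rfl | hx
  · have : (fun x : E => w ‖x‖ * g (‖x‖⁻¹ • x)) =ᶠ[𝓝 0] fun _ => 0 := by
      filter_upwards [ball_mem_nhds (0 : E) one_pos] with x hx
      simp [hw0 x hx]
    exact continuousAt_const.congr this.symm
  · exact (hw.comp continuous_norm).continuousAt.mul
      ((continuousOn_normalize_comp hg).continuousAt (isOpen_compl_singleton.mem_nhds hx))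

/-- The derivative along e of the compactly supported function η(‖x‖) g(x) has integral zero. In
polar coordinates this is a linear relation between the two sphere integrals, with radial constants
A0 and A1 independent of g; their ratio is found by testing on linear functions. -/
theorem sphereIntegral_fderiv [Nontrivial E] {g : E → ℝ}
    (hg : ∀ c > 0, ∀ x, g (c • x) = c * g x) (hg1 : ContDiffOn ℝ 1 g {0}ᶜ) (e : E) :
    sphereIntegral (fun u => fderiv ℝ g u e) =
      finrank ℝ E * sphereIntegral (fun u => g u * ⟪u, e⟫_ℝ) := by
  -- As a function of ‖x‖ this cutoff lives on 1 ≤ ‖x‖ ≤ 3, away from the origin, where g need not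
  -- be differentiable.
  let η : ContDiffBump (2 : ℝ) := ⟨1 / 2, 1, by norm_num, by norm_num⟩
  have hη0 : ∀ x : E, x ∈ ball 0 1 → η ‖x‖ = 0 := by
    intro x hx
    refine η.zero_of_le_dist ?_
    rw [mem_ball_zero_iff] at hx
    rw [Real.dist_eq, abs_of_neg (by linarith)]
    change 1 ≤ _
    linarith
  have hηs : HasCompactSupport fun x : E => η ‖x‖ := by
    refine HasCompactSupport.intro (isCompact_closedBall (0 : E) 3) fun x hx => ?_
    refine η.zero_of_le_dist ?_
    rw [mem_closedBall_zero_iff, not_le] at hx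
    rw [Real.dist_eq, abs_of_pos (by linarith)]
    change 1 ≤ _
    linarith
  set A0 := ∫ r : Ioi (0 : ℝ), η r ∂Measure.volumeIoiPow (finrank ℝ E - 1)
  set A1 := ∫ r : Ioi (0 : ℝ), deriv η r * r ∂Measure.volumeIoiPow (finrank ℝ E - 1)
  have hA0 : A0 ≠ 0 := by
    have h1 := integral_norm_mul_normalize (E := E) η (fun _ => 1)
    simp only [mul_one] at h1
    have hc : Continuous fun x : E => η ‖x‖ := η.continuous.comp continuous_norm
    have h2 : 0 < ∫ x : E, η ‖x‖ := by
      obtain ⟨v, hv⟩ := exists_norm_eq E (zero_le_two (α := ℝ))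
      refine hc.integral_pos_of_hasCompactSupport_nonneg_nonzero hηs (fun x => η.nonneg)
        (x := v) ?_
      rw [hv, η.one_of_mem_closedBall (by simp; norm_num)]
      exact one_ne_zero
    intro h
    rw [h1] at h2
    simp [A0, h] at h2
  have key : ∀ {g : E → ℝ}, (∀ c > 0, ∀ x, g (c • x) = c * g x) → ContDiffOn ℝ 1 g {0}ᶜ →
      ∀ e : E, A1 * sphereIntegral (fun u => g u * ⟪u, e⟫_ℝ) +
        A0 * sphereIntegral (fun u => fderiv ℝ g u e) = 0 := by
    intro g hg hg1 e
    set F : E → ℝ := fun x => η ‖x‖ * g x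
    have hF1 : ContDiff ℝ 1 F := by
      rw [contDiff_iff_contDiffAt]
      intro x
      rcases eq_or_ne x 0 with rfl | hx
      · have : F =ᶠ[𝓝 0] fun _ => 0 := by
          filter_upwards [ball_mem_nhds (0 : E) one_pos] with x hx
          simp [F, hη0 x hx]
        exact contDiffAt_const.congr_of_eventuallyEq this
      · exact (η.contDiff.contDiffAt.comp x (contDiffAt_norm ℝ hx)).mul
          (hg1.contDiffAt (isOpen_compl_singleton.mem_nhds hx))
    have hFs : HasCompactSupport F := hηs.mul_right
    have h0 : ∫ x, fderiv ℝ F x e = 0 := by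
      have := integral_bilinear_hasFDerivAt_right_eq_neg_left_of_integrable (μ := volume)
        (f := fun _ : E => (1 : ℝ)) (f' := fun _ => 0) (g := F) (g' := fderiv ℝ F) (v := e)
        (B := ContinuousLinearMap.mul ℝ ℝ) (by simp) ?_ ?_ (fun x _ => hasFDerivAt_const _ _)
        (fun x _ => (hF1.differentiable one_ne_zero x).hasFDerivAt)
      · simpa using this
      · simp only [ContinuousLinearMap.mul_apply', one_mul]
        refine Continuous.integrable_of_hasCompactSupport ?_ ?_
        · exact (hF1.continuous_fderiv one_ne_zero).clm_apply continuous_const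
        · exact hFs.fderiv_apply ℝ e
      · simpa using hF1.continuous.integrable_of_hasCompactSupport hFs
    have h1 : ∀ x : E, fderiv ℝ F x e = (deriv η ‖x‖ * ‖x‖) *
        (g (‖x‖⁻¹ • x) * ⟪‖x‖⁻¹ • x, e⟫_ℝ) + η ‖x‖ * fderiv ℝ g (‖x‖⁻¹ • x) e := by
      intro x
      rcases eq_or_ne x 0 with rfl | hx
      · have : F =ᶠ[𝓝 0] fun _ => 0 := by
          filter_upwards [ball_mem_nhds (0 : E) one_pos] with x hx
          simp [F, hη0 x hx]
        rw [this.fderiv_eq]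
        simp [show η 0 = 0 by simpa using hη0 0 (by simp)]
      · have hx' : 0 < ‖x‖ := norm_pos_iff.2 hx
        have d1 : HasFDerivAt (fun x : E => ‖x‖) (‖x‖⁻¹ • innerSL ℝ x) x := by
          exact hasFDerivAt_norm_of_ne_zero hx
        have d2 : HasDerivAt η (deriv η ‖x‖) ‖x‖ :=
          ((η.contDiff (n := 1)).differentiable one_ne_zero _).hasDerivAt
        have d3 : HasFDerivAt g (fderiv ℝ g x) x :=
          ((hg1.contDiffAt (isOpen_compl_singleton.mem_nhds hx)).differentiableAt
            one_ne_zero).hasFDerivAt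
        have d4 := (d2.comp_hasFDerivAt x d1).mul d3
        rw [fderiv_smul_eq_of_homogeneous hg (inv_pos.2 hx'), hg _ (inv_pos.2 hx')]
        have d5 : fderiv ℝ F x = _ := d4.fderiv
        rw [d5]
        simp [inner_smul_left]
        field_simp
        ring
    have hsub : sphere (0 : E) 1 ⊆ {0}ᶜ := fun x hx => by
      simpa using ne_zero_of_mem_unit_sphere ⟨x, hx⟩
    have hgc : ContinuousOn (fun u : E => g u * ⟪u, e⟫_ℝ) (sphere 0 1) :=
      (hg1.continuousOn.mono hsub).mul (by fun_prop)
    have hdc : ContinuousOn (fun u : E => fderiv ℝ g u e) (sphere 0 1) :=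
      ((hg1.continuousOn_fderiv_of_isOpen isOpen_compl_singleton le_rfl).mono hsub).clm_apply
        continuousOn_const
    have hη' : Continuous fun r => deriv η r * r :=
      ((η.contDiff (n := 1)).continuous_deriv le_rfl).mul continuous_id
    have hη'd : ∀ r, 1 < dist r 2 → deriv η r = 0 := by
      intro r hr
      have : η =ᶠ[𝓝 r] fun _ => 0 := by
        filter_upwards [(isOpen_lt continuous_const (continuous_id.dist continuous_const)).mem_nhds
          hr] with s hs
        exact η.zero_of_le_dist (le_of_lt hs)
      rw [this.deriv_eq, deriv_const]
    have hη'0 : ∀ x : E, x ∈ ball 0 1 → deriv η ‖x‖ * ‖x‖ = 0 := by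
      intro x hx
      rw [mem_ball_zero_iff] at hx
      rw [hη'd _ (by rw [Real.dist_eq, abs_of_neg] <;> linarith), zero_mul]
    have hη's : HasCompactSupport fun x : E => deriv η ‖x‖ * ‖x‖ := by
      refine HasCompactSupport.intro (isCompact_closedBall (0 : E) 3) fun x hx => ?_
      rw [mem_closedBall_zero_iff, not_le] at hx
      rw [hη'd _ (by rw [Real.dist_eq, abs_of_pos] <;> linarith), zero_mul]
    simp_rw [h1] at h0
    rw [integral_add (integrable_norm_mul_normalize (w := fun r => deriv η r * r) hη' hη'0 hη's hgc)
      (integrable_norm_mul_normalize η.continuous hη0 hηs hdc),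
      integral_norm_mul_normalize (fun r => deriv η r * r) (fun u => g u * ⟪u, e⟫_ℝ),
      integral_norm_mul_normalize η (fun u => fderiv ℝ g u e)] at h0
    exact h0
  -- Take g = ⟪·, b i⟫ and e = b i, and sum over i, using ∑ ⟪u, b i⟫² = 1 on the sphere.
  have hA : A1 = - (finrank ℝ E * A0) := by
    set b := stdOrthonormalBasis ℝ E
    have hlin : ∀ i, A1 * sphereIntegral (fun u => ⟪u, b i⟫_ℝ * ⟪u, b i⟫_ℝ) +
        A0 * sphereIntegral (fun _ : E => (1 : ℝ)) = 0 := by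
      intro i
      have h1 := key (g := fun x => ⟪x, b i⟫_ℝ) (fun c _ x => by simp [inner_smul_left])
        (contDiff_id.inner ℝ contDiff_const).contDiffOn (b i)
      have h2 : ∀ u : E, fderiv ℝ (fun x => ⟪x, b i⟫_ℝ) u (b i) = 1 := by
        intro u
        rw [fderiv_inner_apply ℝ differentiableAt_fun_id (differentiableAt_const _)]
        simp
      simpa only [h2] using h1
    have hsum := Finset.sum_eq_zero (s := Finset.univ) fun i _ => hlin i
    rw [Finset.sum_add_distrib, ← Finset.mul_sum, ← sphereIntegral_sum _ fun i _ => by fun_prop,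
      sphereIntegral_congr (g := fun _ => (1 : ℝ)) fun u hu => ?_] at hsum
    · have hω := sphereIntegral_one_pos (E := E)
      simp only [Finset.sum_const, Finset.card_univ, Fintype.card_fin, nsmul_eq_mul] at hsum
      have : sphereIntegral (fun _ : E => (1 : ℝ)) * (A1 + finrank ℝ E * A0) = 0 := by
        linarith
      linarith [(mul_eq_zero.1 this).resolve_left hω.ne']
    · have := b.sum_inner_mul_inner u u
      simp only [real_inner_self_eq_norm_sq, hu] at this
      rw [← one_pow 2, ← this]
      exact Finset.sum_congr rfl fun i _ => by rw [real_inner_comm (b i) u]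
  have := key hg hg1 e
  rw [hA] at this
  have h3 : A0 * (sphereIntegral (fun u => fderiv ℝ g u e) -
      finrank ℝ E * sphereIntegral (fun u => g u * ⟪u, e⟫_ℝ)) = 0 := by linarith
  exact sub_eq_zero.1 ((mul_eq_zero.1 h3).resolve_left hA0)

end SphereIntegral

/-! ### Elementary inequalities -/

theorem exists_one_add_pow_le (d : ℕ) :
    ∃ C : ℝ, 0 ≤ C ∧ ∀ y : ℝ, |y| ≤ 1 → (1 + y) ^ d ≤ 1 + d * y + C * y ^ 2 := by
  induction d with
  | zero => exact ⟨0, le_rfl, fun y _ => by simp⟩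
  | succ d ih =>
    obtain ⟨C, hC, h⟩ := ih
    refine ⟨d + 2 * C, by positivity, fun y hy => ?_⟩
    have hy' := abs_le.1 hy
    have h1 := mul_le_mul_of_nonneg_right (h y hy) (show 0 ≤ 1 + y by linarith)
    rw [← pow_succ] at h1
    push_cast
    have h2 : 0 ≤ C * y ^ 2 * (1 - y) := by
      have : 0 ≤ 1 - y := by linarith
      positivity
    nlinarith

theorem exists_le_inv_one_sub_pow (d : ℕ) :
    ∃ C : ℝ, 0 ≤ C ∧ ∀ a : ℝ, |a| ≤ 1 / 2 →
      1 + d * a + d * (d + 1) / 2 * a ^ 2 - C * |a| ^ 3 ≤ ((1 - a)⁻¹) ^ d := by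
  induction d with
  | zero => exact ⟨0, le_rfl, fun y _ => by simp⟩
  | succ d ih =>
    obtain ⟨C, hC, h⟩ := ih
    refine ⟨2 * C + (d + 1) * (d + 2), by positivity, fun a ha => ?_⟩
    have ha' := abs_le.1 ha
    have hpos : 0 < 1 - a := by linarith
    have h1 := mul_le_mul_of_nonneg_right (h a ha) (inv_nonneg.2 hpos.le)
    rw [← pow_succ] at h1
    refine le_trans ?_ h1
    rw [← div_eq_mul_inv, le_div_iff₀ hpos]
    push_cast
    have h3 : a ^ 3 ≤ |a| ^ 3 := by rw [← abs_pow]; exact le_abs_self _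
    have h4 : -(|a| ^ 3) ≤ a ^ 3 := by rw [← abs_pow]; exact neg_abs_le _
    have h5 : 0 ≤ |a| ^ 3 * (1 / 2 - a) * (2 * C + (d + 1) * (d + 2)) := by
      have : 0 ≤ 1 / 2 - a := by linarith
      positivity
    have h6 : 0 ≤ ((d : ℝ) + 1) * (d + 2) / 2 * (|a| ^ 3 + a ^ 3) := by
      have : 0 ≤ |a| ^ 3 + a ^ 3 := by linarith
      positivity
    nlinarith

theorem abs_radius_perturbation_le {M ε t h φ D : ℝ} (hε : 0 < ε) (hε1 : ε ≤ 1)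
    (ht : 0 < t) (ht1 : t * (2 * M ^ 2 + 1 + M) ≤ 1) (hM : 1 ≤ M)
    (hh : 0 < h) (hhM : h ≤ M) (hφ : |φ| ≤ M) (hD : |D| ≤ M) :
    |t * φ + t ^ 2 * (φ ^ 2 + h * D / 2 + ε)| ≤ t * (2 * M ^ 2 + 1 + M) := by
  have ht2 : t ≤ 1 := by nlinarith [sq_nonneg M]
  set Q := φ ^ 2 + h * D / 2 + ε with hQ
  have hφ2 : φ ^ 2 ≤ M ^ 2 := sq_le_sq' (abs_le.1 hφ).1 (abs_le.1 hφ).2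
  have hhD : |h * D| ≤ M ^ 2 := by
    rw [abs_mul, abs_of_pos hh, sq]; exact mul_le_mul hhM hD (abs_nonneg _) (by linarith)
  have hQB : |Q| ≤ 2 * M ^ 2 + 1 := by
    have := abs_le.1 hhD
    rw [abs_le]; constructor <;> nlinarith [sq_nonneg φ, sq_nonneg M]
  calc |t * φ + t ^ 2 * Q| ≤ |t * φ| + |t ^ 2 * Q| := abs_add_le _ _
    _ = t * |φ| + t ^ 2 * |Q| := by rw [abs_mul, abs_mul, abs_of_pos ht, abs_of_pos (pow_pos ht 2)]
    _ ≤ t * M + t * (2 * M ^ 2 + 1) := by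
      gcongr
      nlinarith [ht2]
    _ = _ := by ring

/-- The equation l = h + tlφ + (tl)²D/2 has the second-order solution l = h(1 + tφ + t²(φ² + hD/2)).
The extra ε in the t² coefficient absorbs the higher-order terms and a Taylor error. -/
theorem quadratic_radius_estimate {M ε t h φ D : ℝ} (hε : 0 < ε) (hε1 : ε ≤ 1)
    (ht : 0 < t) (ht1 : t * (2 * M ^ 2 + 1 + M) ≤ 1)
    (htε : t * (M * (2 * M ^ 2 + 1) + 2 * M ^ 2 * (2 * M ^ 2 + 1 + M)) ≤ ε / 2)
    (hM : 1 ≤ M)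
    (hh : 0 < h) (hhM : h ≤ M) (hφ : |φ| ≤ M) (hD : |D| ≤ M) :
    h + t * (h * (1 + (t * φ + t ^ 2 * (φ ^ 2 + h * D / 2 + ε)))) * φ +
      (t * (h * (1 + (t * φ + t ^ 2 * (φ ^ 2 + h * D / 2 + ε))))) ^ 2 * D / 2 +
      ε / (8 * M) * (t * (h * (1 + (t * φ + t ^ 2 * (φ ^ 2 + h * D / 2 + ε))))) ^ 2
      ≤ h * (1 + (t * φ + t ^ 2 * (φ ^ 2 + h * D / 2 + ε))) := by
  have ht2 : t ≤ 1 := by nlinarith [sq_nonneg M]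
  set Q := φ ^ 2 + h * D / 2 + ε with hQ
  set y := t * φ + t ^ 2 * Q with hy
  have hφ2 : φ ^ 2 ≤ M ^ 2 := sq_le_sq' (abs_le.1 hφ).1 (abs_le.1 hφ).2
  have hhD : |h * D| ≤ M ^ 2 := by
    rw [abs_mul, abs_of_pos hh, sq]; exact mul_le_mul hhM hD (abs_nonneg _) (by linarith)
  have hQB : |Q| ≤ 2 * M ^ 2 + 1 := by
    have := abs_le.1 hhD
    rw [abs_le]; constructor <;> nlinarith [sq_nonneg φ, sq_nonneg M]
  have hyN : |y| ≤ t * (2 * M ^ 2 + 1 + M) :=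
    abs_radius_perturbation_le hε hε1 ht ht1 hM hh hhM hφ hD
  have hy1 : |y| ≤ 1 := hyN.trans ht1
  have hy1' := abs_le.1 hy1
  have hsq : (1 + y) ^ 2 ≤ 4 := by nlinarith
  have hsq1 : |(1 + y) ^ 2 - 1| ≤ 3 * (t * (2 * M ^ 2 + 1 + M)) := by
    have : (1 + y) ^ 2 - 1 = y * (2 + y) := by ring
    rw [this, abs_mul, mul_comm]
    have : |2 + y| ≤ 3 := by rw [abs_le]; constructor <;> linarith
    gcongr
  have b1 : t * φ * Q ≤ t * (M * (2 * M ^ 2 + 1)) := by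
    calc t * φ * Q ≤ |t * φ * Q| := le_abs_self _
      _ = t * (|φ| * |Q|) := by rw [abs_mul, abs_mul, abs_of_pos ht]; ring
      _ ≤ _ := by gcongr
  have b2 : h * D / 2 * ((1 + y) ^ 2 - 1) ≤ M ^ 2 / 2 * (3 * (t * (2 * M ^ 2 + 1 + M))) := by
    calc h * D / 2 * ((1 + y) ^ 2 - 1) ≤ |h * D / 2 * ((1 + y) ^ 2 - 1)| := le_abs_self _
      _ = |h * D| / 2 * |(1 + y) ^ 2 - 1| := by rw [abs_mul, abs_div, abs_two]
      _ ≤ _ := by gcongr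
  -- As h ≤ M and (1 + y)² ≤ 4, the factor 8M makes the Taylor error cost at most half of ε; `htε`
  -- keeps the other half for `b1` and `b2`.
  have b3 : ε / (8 * M) * h * (1 + y) ^ 2 ≤ ε / 2 := by
    calc ε / (8 * M) * h * (1 + y) ^ 2 ≤ ε / (8 * M) * M * 4 := by gcongr
      _ = ε / 2 := by field_simp; norm_num
  have hN : 0 ≤ M ^ 2 * (t * (2 * M ^ 2 + 1 + M)) := by positivity
  have key : 0 ≤ h * t ^ 2 * (ε - t * φ * Q - h * D / 2 * ((1 + y) ^ 2 - 1) -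
      ε / (8 * M) * h * (1 + y) ^ 2) := by
    refine mul_nonneg (by positivity) ?_
    nlinarith
  have e : h * (1 + y) - (h + t * (h * (1 + y)) * φ + (t * (h * (1 + y))) ^ 2 * D / 2 +
      ε / (8 * M) * (t * (h * (1 + y))) ^ 2) = h * t ^ 2 * (ε - t * φ * Q -
      h * D / 2 * ((1 + y) ^ 2 - 1) - ε / (8 * M) * h * (1 + y) ^ 2) := by
    rw [hy, hQ]; ring
  linarith

/-! ### Parametrization of a convex hypersurface by its normals -/

/-- `X` is the inverse Gauss map, extended to be homogeneous of degree zero, of a strictly convex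
hypersurface of class `C^1` around the origin, whose cone volume measure is the surface measure of
the unit sphere: the Gauss curvature at `X u` is the support function `⟪X u, u⟫`. -/
structure IsIsotropicInverseGaussMap {E : Type*} [NormedAddCommGroup E] [InnerProductSpace ℝ E]
    (X : E → E) : Prop where
  contDiffOn : ContDiffOn ℝ 1 X {0}ᶜ
  smul : ∀ c > (0 : ℝ), ∀ x, X (c • x) = X x
  inner_le : ∀ u v, u ≠ 0 → v ≠ 0 → ⟪X v, u⟫_ℝ ≤ ⟪X u, u⟫_ℝ
  inner_pos : ∀ u, u ≠ 0 → 0 < ⟪X u, u⟫_ℝ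
  surj : ∀ y : E, y ≠ 0 → ∃ x, x ≠ 0 ∧ ‖x‖ • X x = y
  injOn : InjOn (fun x => ‖x‖ • X x) {0}ᶜ
  det : ∀ u, ‖u‖ = 1 → ∀ T : (ℝ ∙ u)ᗮ →ₗ[ℝ] (ℝ ∙ u)ᗮ,
    (∀ v, (T v : E) = fderiv ℝ X u v) → ⟪X u, u⟫_ℝ * LinearMap.det T = 1

/-- L is block triangular: it preserves the hyperplane orthogonal to u and acts on the
one-dimensional quotient by the scalar ⟪L u, u⟫. -/
theorem det_eq_inner_mul_det_orthogonal {E : Type*} [NormedAddCommGroup E] [InnerProductSpace ℝ E]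
    [FiniteDimensional ℝ E] (L : E →ₗ[ℝ] E) {u : E} (hu : ‖u‖ = 1)
    (T : (ℝ ∙ u)ᗮ →ₗ[ℝ] (ℝ ∙ u)ᗮ) (hT : ∀ v, (T v : E) = L v) :
    LinearMap.det L = ⟪L u, u⟫_ℝ * LinearMap.det T := by
  have hmaps : (ℝ ∙ u)ᗮ ≤ Submodule.comap L (ℝ ∙ u)ᗮ := fun v hv => by
    have := (T ⟨v, hv⟩).2
    rwa [hT] at this
  rw [LinearMap.det_eq_det_mul_det (ℝ ∙ u)ᗮ L hmaps, mul_comm]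
  have hu0 : u ≠ 0 := norm_ne_zero_iff.1 (by simp [hu])
  congr 1
  · have hq : (ℝ ∙ u)ᗮ.mapQ (ℝ ∙ u)ᗮ L hmaps = ⟪L u, u⟫_ℝ • LinearMap.id := by
      refine Submodule.linearMap_qext _ (LinearMap.ext fun v => ?_)
      simp only [LinearMap.comp_apply, Submodule.mkQ_apply, Submodule.mapQ_apply,
        LinearMap.smul_apply, LinearMap.id_apply]
      rw [← Submodule.Quotient.mk_smul, Submodule.Quotient.eq]
      have hv : v - ⟪u, v⟫_ℝ • u ∈ (ℝ ∙ u)ᗮ := by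
        rw [Submodule.mem_orthogonal_singleton_iff_inner_right]
        simp [inner_sub_right, inner_smul_right, hu]
      have h1 := hmaps hv
      rw [Submodule.mem_comap, Submodule.mem_orthogonal_singleton_iff_inner_right, map_sub,
        map_smul, inner_sub_right, inner_smul_right] at h1
      rw [Submodule.mem_orthogonal_singleton_iff_inner_right, inner_sub_right, inner_smul_right,
        real_inner_comm u (L u)]
      linarith
    rw [hq, LinearMap.det_smul, LinearMap.det_id, mul_one]
    have : finrank ℝ (E ⧸ (ℝ ∙ u)ᗮ) = 1 := by
      have h1 := Submodule.finrank_quotient_add_finrank (ℝ ∙ u)ᗮ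
      have h2 := Submodule.finrank_add_finrank_orthogonal (ℝ ∙ u)
      rw [finrank_span_singleton hu0] at h2
      omega
    rw [this, pow_one]
  · congr 1
    ext v
    simp [hT]

theorem sphere_one_subset_compl_zero {E : Type*} [NormedAddCommGroup E] :
    sphere (0 : E) 1 ⊆ {0}ᶜ := fun x hx hx0 => by
  rw [mem_singleton_iff.1 hx0] at hx
  simp at hx

namespace IsIsotropicInverseGaussMap

variable {E : Type*} [NormedAddCommGroup E] [InnerProductSpace ℝ E] {X : E → E}

theorem hasFDerivAt (hX : IsIsotropicInverseGaussMap X) {u : E} (hu : u ≠ 0) :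
    HasFDerivAt X (fderiv ℝ X u) u :=
  ((hX.contDiffOn.contDiffAt (isOpen_compl_singleton.mem_nhds hu)).differentiableAt
    one_ne_zero).hasFDerivAt

theorem continuousAt (hX : IsIsotropicInverseGaussMap X) {u : E} (hu : u ≠ 0) :
    ContinuousAt X u := (hX.hasFDerivAt hu).continuousAt

theorem continuousOn_fderiv (hX : IsIsotropicInverseGaussMap X) :
    ContinuousOn (fderiv ℝ X) {0}ᶜ :=
  hX.contDiffOn.continuousOn_fderiv_of_isOpen isOpen_compl_singleton le_rfl

theorem continuousOn_sphere (hX : IsIsotropicInverseGaussMap X) :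
    ContinuousOn X (sphere 0 1) := hX.contDiffOn.continuousOn.mono sphere_one_subset_compl_zero

/-- Envelope argument: two uses of `inner_le` give 0 ≤ h(u + w) - h(u) - ⟪X u, w⟫ ≤ ⟪X(u + w) - X u,
w⟫, which is o(‖w‖) by continuity of X. -/
theorem hasFDerivAt_support (hX : IsIsotropicInverseGaussMap X) {u : E} (hu : u ≠ 0) :
    HasFDerivAt (fun x => ⟪X x, x⟫_ℝ) (innerSL ℝ (X u)) u := by
  rw [hasFDerivAt_iff_isLittleO_nhds_zero, Asymptotics.isLittleO_iff]
  intro c hc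
  have h1 : ∀ᶠ w in 𝓝 (0 : E), ‖X (u + w) - X u‖ ≤ c := by
    have h2 : Tendsto (fun w => ‖X (u + w) - X u‖) (𝓝 0) (𝓝 0) := by
      have h3 : Tendsto (fun w => X (u + w)) (𝓝 0) (𝓝 (X u)) := by
        have := (hX.continuousAt hu).tendsto
        have h4 : Tendsto (fun w => u + w) (𝓝 0) (𝓝 u) := by
          simpa using (continuous_const_add u).tendsto 0
        exact this.comp h4
      simpa using (h3.sub_const (X u)).norm
    exact h2.eventually_le_const hc
  have h2 : ∀ᶠ w in 𝓝 (0 : E), u + w ≠ 0 := by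
    have : Tendsto (fun w => u + w) (𝓝 0) (𝓝 u) := by
      simpa using (continuous_const_add u).tendsto 0
    exact this.eventually_ne hu
  filter_upwards [h1, h2] with w hw hw0
  have h3 := hX.inner_le (u + w) u hw0 hu
  have h4 := hX.inner_le u (u + w) hu hw0
  have h5 : ⟪X (u + w) - X u, w⟫_ℝ ≤ c * ‖w‖ :=
    (real_inner_le_norm _ _).trans (by gcongr)
  simp only [inner_add_right, inner_sub_left, innerSL_apply_apply] at h3 h4 h5 ⊢
  rw [Real.norm_eq_abs, abs_le]
  constructor <;> [nlinarith [norm_nonneg w]; linarith]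

/-- Second-order Taylor bound for the support function, uniform in u because dX is uniformly
continuous on a compact shell around the unit sphere. -/
theorem exists_quadratic_upper_bound (hX : IsIsotropicInverseGaussMap X) [FiniteDimensional ℝ E]
    {ε : ℝ} (hε : 0 < ε) : ∃ δ > 0, ∀ u w : E, ‖u‖ = 1 → ‖w‖ ≤ δ →
      ⟪X (u + w), u + w⟫_ℝ ≤ ⟪X u, u⟫_ℝ + ⟪X u, w⟫_ℝ + ⟪fderiv ℝ X u w, w⟫_ℝ / 2
        + ε * ‖w‖ ^ 2 := by
  set K : Set E := closedBall 0 2 \ ball 0 (1 / 2)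
  have hK : IsCompact K := (isCompact_closedBall _ _).diff isOpen_ball
  have hK0 : K ⊆ {0}ᶜ := fun x hx hx0 => hx.2 (by rw [mem_singleton_iff.1 hx0]; simp)
  have huc := hK.uniformContinuousOn_of_continuous (hX.continuousOn_fderiv.mono hK0)
  obtain ⟨δ, hδ, h⟩ := Metric.uniformContinuousOn_iff_le.1 huc ε hε
  refine ⟨min δ (1 / 2), by positivity, fun u w hu hw => ?_⟩
  have hw1 : ‖w‖ ≤ δ := hw.trans (min_le_left _ _)
  have hw2 : ‖w‖ ≤ 1 / 2 := hw.trans (min_le_right _ _)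
  have hballK : ∀ x ∈ closedBall u ‖w‖, x ∈ K := by
    intro x hx
    rw [mem_closedBall, dist_eq_norm] at hx
    have h1 := norm_sub_norm_le u x
    have h2 := norm_sub_norm_le x u
    rw [norm_sub_rev u x] at h1
    simp only [K, Set.mem_sdiff, mem_closedBall_zero_iff, mem_ball_zero_iff, not_lt]
    constructor <;> linarith
  have huK : u ∈ K := hballK u (mem_closedBall_self (norm_nonneg _))
  have hmv : ∀ x ∈ closedBall u ‖w‖, ‖X x - X u - fderiv ℝ X u (x - u)‖ ≤ ε * ‖x - u‖ := by
    intro x hx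
    refine (convex_closedBall u ‖w‖).norm_image_sub_le_of_norm_hasFDerivWithin_le'
      (f' := fderiv ℝ X) (fun y hy => (hX.hasFDerivAt (hK0 (hballK y hy))).hasFDerivWithinAt)
      (fun y hy => ?_) (mem_closedBall_self (norm_nonneg _)) hx
    rw [← dist_eq_norm]
    refine h y (hballK y hy) u huK ?_
    exact (mem_closedBall.1 hy).trans hw1
  have hseg : ∀ s ∈ Icc (0 : ℝ) 1, u + s • w ∈ closedBall u ‖w‖ := by
    intro s hs
    rw [mem_closedBall, dist_eq_norm, add_sub_cancel_left, norm_smul, Real.norm_of_nonneg hs.1]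
    exact mul_le_of_le_one_left (norm_nonneg _) hs.2
  set m : ℝ → ℝ := fun s => ⟪X (u + s • w), u + s • w⟫_ℝ - (s * ⟪X u, w⟫_ℝ +
    s ^ 2 * (⟪fderiv ℝ X u w, w⟫_ℝ / 2 + ε * ‖w‖ ^ 2))
  have hder : ∀ s ∈ Icc (0 : ℝ) 1, HasDerivAt m (⟪X (u + s • w), w⟫_ℝ - (⟪X u, w⟫_ℝ +
      2 * s * (⟪fderiv ℝ X u w, w⟫_ℝ / 2 + ε * ‖w‖ ^ 2))) s := by
    intro s hs
    have d1 : HasDerivAt (fun s : ℝ => u + s • w) w s := by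
      simpa using ((hasDerivAt_id s).smul_const w).const_add u
    have d2 := (hX.hasFDerivAt_support (hK0 (hballK _ (hseg s hs)))).comp_hasDerivAt s d1
    have d3 : HasDerivAt (fun s : ℝ => s * ⟪X u, w⟫_ℝ +
        s ^ 2 * (⟪fderiv ℝ X u w, w⟫_ℝ / 2 + ε * ‖w‖ ^ 2)) (⟪X u, w⟫_ℝ +
        2 * s * (⟪fderiv ℝ X u w, w⟫_ℝ / 2 + ε * ‖w‖ ^ 2)) s := by
      have d4 := ((hasDerivAt_id s).mul_const ⟪X u, w⟫_ℝ).add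
        ((hasDerivAt_pow 2 s).mul_const (⟪fderiv ℝ X u w, w⟫_ℝ / 2 + ε * ‖w‖ ^ 2))
      simp only [Nat.cast_ofNat, Nat.add_one_sub_one, pow_one, one_mul] at d4
      exact d4
    exact d2.sub d3
  -- The slope of m is ⟪X(u + sw) - X u - s dX w, w⟫ - 2sε‖w‖², and the first term is at most
  -- sε‖w‖².
  have hanti : AntitoneOn m (Icc 0 1) := by
    refine antitoneOn_of_deriv_nonpos (convex_Icc 0 1)
      (fun s hs => (hder s hs).continuousAt.continuousWithinAt)
      (fun s hs => (hder s (interior_subset hs)).differentiableAt.differentiableWithinAt)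
      fun s hs => ?_
    have hs' := interior_subset hs
    rw [(hder s hs').deriv]
    have h1 := hmv _ (hseg s hs')
    rw [add_sub_cancel_left, norm_smul, Real.norm_of_nonneg hs'.1, map_smul] at h1
    have h2 := real_inner_le_norm (X (u + s • w) - X u - s • fderiv ℝ X u w) w
    have h3 : ‖X (u + s • w) - X u - s • fderiv ℝ X u w‖ * ‖w‖ ≤ ε * (s * ‖w‖) * ‖w‖ := by gcongr
    simp only [inner_sub_left, inner_smul_left, RCLike.conj_to_real] at h2
    have h4 : 0 ≤ ε * (s * ‖w‖) * ‖w‖ := by have := hs'.1; positivity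
    nlinarith
  have := hanti (left_mem_Icc.2 zero_le_one) (right_mem_Icc.2 zero_le_one) zero_le_one
  simp only [m, one_smul, zero_smul, add_zero] at this
  linarith

end IsIsotropicInverseGaussMap

/-! ### The volume-preserving map x ↦ ‖x‖ • X x and support bounds for images of star bodies -/

namespace IsIsotropicInverseGaussMap

variable {E : Type*} [NormedAddCommGroup E] [InnerProductSpace ℝ E] {X : E → E}

/-- The product rule for ⟪X x, x⟫ has this additional term compared with `hasFDerivAt_support`. -/
theorem inner_fderiv_self (hX : IsIsotropicInverseGaussMap X) {u : E} (hu : u ≠ 0) (v : E) :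
    ⟪fderiv ℝ X u v, u⟫_ℝ = 0 := by
  have h1 := (hX.hasFDerivAt hu).inner ℝ (hasFDerivAt_id u)
  have h2 := congrArg (fun L => L v) (h1.unique (hX.hasFDerivAt_support hu))
  simp only [ContinuousLinearMap.comp_apply, fderivInnerCLM_apply,
    ContinuousLinearMap.prod_apply, innerSL_apply_apply, id] at h2
  simpa using h2

/-- The differential of the inverse Gauss map, as an endomorphism of the tangent space. -/
theorem exists_tangentMap (hX : IsIsotropicInverseGaussMap X) {u : E} (hu : u ≠ 0) :
    ∃ T : (ℝ ∙ u)ᗮ →ₗ[ℝ] (ℝ ∙ u)ᗮ, ∀ v, (T v : E) = fderiv ℝ X u v := by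
  refine ⟨((fderiv ℝ X u : E →ₗ[ℝ] E) ∘ₗ (ℝ ∙ u)ᗮ.subtype).codRestrict _ fun v => ?_, fun v => rfl⟩
  rw [Submodule.mem_orthogonal_singleton_iff_inner_left]
  exact hX.inner_fderiv_self hu v

theorem hasFDerivAt_cone (hX : IsIsotropicInverseGaussMap X) {x : E} (hx : x ≠ 0) :
    HasFDerivAt (fun x => ‖x‖ • X x)
      (‖x‖ • fderiv ℝ X x + (‖x‖⁻¹ • innerSL ℝ x).smulRight (X x)) x :=
  (hasFDerivAt_norm_of_ne_zero hx).smul (hX.hasFDerivAt hx)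

/-- By homogeneity x may be taken to be a unit vector u. The differential restricts to dX on the
hyperplane orthogonal to u, and the image of u has u-component h(u), so the determinant is h · det
dX. -/
theorem det_fderiv_cone (hX : IsIsotropicInverseGaussMap X) [FiniteDimensional ℝ E] {x : E}
    (hx : x ≠ 0) : (fderiv ℝ (fun x => ‖x‖ • X x) x).det = 1 := by
  have hx' : 0 < ‖x‖ := norm_pos_iff.2 hx
  have hhom : ∀ c > (0 : ℝ), ∀ x, ‖c • x‖ • X (c • x) = c • (‖x‖ • X x) := fun c hc x => by
    rw [hX.smul c hc, norm_smul, Real.norm_of_nonneg hc.le, mul_smul]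
  rw [← fderiv_smul_eq_of_homogeneous hhom (inv_pos.2 hx')]
  set u := ‖x‖⁻¹ • x
  have hu : ‖u‖ = 1 := by simp [u, norm_smul, hx'.ne']
  have hu0 : u ≠ 0 := norm_ne_zero_iff.1 (by simp [hu])
  obtain ⟨T, hT⟩ := hX.exists_tangentMap hu0
  have hfd : fderiv ℝ (fun x => ‖x‖ • X x) u = _ := (hX.hasFDerivAt_cone hu0).fderiv
  rw [hfd, ContinuousLinearMap.det, det_eq_inner_mul_det_orthogonal _ hu T]
  · rw [← hX.det u hu T hT]
    have := hX.inner_fderiv_self hu0 u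
    simp [hu, inner_add_left, this]
  · intro v
    have hv := Submodule.mem_orthogonal_singleton_iff_inner_right.1 v.2
    simp [hT, hu, hv]

theorem volume_image_cone (hX : IsIsotropicInverseGaussMap X) [FiniteDimensional ℝ E]
    [MeasurableSpace E] [BorelSpace E] {S : Set E} (hS : MeasurableSet S) (hS0 : S ⊆ {0}ᶜ) :
    volume ((fun x => ‖x‖ • X x) '' S) = volume S := by
  have := lintegral_image_eq_lintegral_abs_det_fderiv_mul volume hS
    (fun x hx => (hX.hasFDerivAt_cone (hS0 hx)).differentiableAt.hasFDerivAt.hasFDerivWithinAt)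
    (hX.injOn.mono hS0) (fun _ => 1)
  simp only [setLIntegral_one, mul_one] at this
  rw [this]
  rw [setLIntegral_congr_fun hS (g := fun _ => 1) fun _ hx => by
    simp [hX.det_fderiv_cone (hS0 hx)]]
  simp

theorem measurableSet_image_cone (hX : IsIsotropicInverseGaussMap X) [FiniteDimensional ℝ E]
    [MeasurableSpace E] [BorelSpace E] {S : Set E} (hS : MeasurableSet S) (hS0 : S ⊆ {0}ᶜ) :
    MeasurableSet ((fun x => ‖x‖ • X x) '' S) :=
  measurable_image_of_fderivWithin hS
    (fun _ hx => (hX.hasFDerivAt_cone (hS0 hx)).hasFDerivWithinAt) (hX.injOn.mono hS0)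

theorem continuousOn_support (hX : IsIsotropicInverseGaussMap X) :
    ContinuousOn (fun u => ⟪X u, u⟫_ℝ) (sphere 0 1) :=
  hX.continuousOn_sphere.inner continuousOn_id

theorem continuousOn_inner (hX : IsIsotropicInverseGaussMap X) (e : E) :
    ContinuousOn (fun u => ⟪X u, e⟫_ℝ) (sphere 0 1) :=
  hX.continuousOn_sphere.inner continuousOn_const

theorem continuousOn_hessian (hX : IsIsotropicInverseGaussMap X) (e : E) :
    ContinuousOn (fun u => ⟪fderiv ℝ X u e, e⟫_ℝ) (sphere 0 1) :=
  ((hX.continuousOn_fderiv.mono sphere_one_subset_compl_zero).clm_apply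
    continuousOn_const).inner continuousOn_const

theorem exists_uniform_bound (hX : IsIsotropicInverseGaussMap X) [FiniteDimensional ℝ E]
    (e : E) (c : ℝ) : ∃ M : ℝ, 1 ≤ M ∧ ∀ u : E, ‖u‖ = 1 → ⟪X u, u⟫_ℝ ≤ M ∧
      |⟪X u, e⟫_ℝ - c| ≤ M ∧ |⟪fderiv ℝ X u e, e⟫_ℝ| ≤ M := by
  have hK := isCompact_sphere (0 : E) 1
  obtain ⟨M1, h1⟩ := hK.exists_bound_of_continuousOn hX.continuousOn_support
  obtain ⟨M2, h2⟩ := hK.exists_bound_of_continuousOn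
    ((hX.continuousOn_inner e).sub (continuousOn_const (c := c)))
  obtain ⟨M3, h3⟩ := hK.exists_bound_of_continuousOn (hX.continuousOn_hessian e)
  refine ⟨max 1 (max M1 (max M2 M3)), le_max_left _ _, fun u hu => ⟨?_, ?_, ?_⟩⟩
  · exact (le_abs_self _).trans ((h1 u (by simpa using hu)).trans (by simp))
  · exact (h2 u (by simpa using hu)).trans (by simp)
  · exact (h3 u (by simpa using hu)).trans (by simp)

/-- If l > 0 satisfies h(u + tle) ≤ (1 + tc)l, then testing the support function at u + tle against
X v gives ⟪X v, u⟫ ≤ l(1 - t(⟪X v, e⟫ - c)), and multiplying by r bounds r⟪X v, u⟫ by l. The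
right-hand side is such an l, by `quadratic_radius_estimate`. -/
theorem exists_support_bound_of_radial (hX : IsIsotropicInverseGaussMap X)
    [FiniteDimensional ℝ E] {e : E} (he : ‖e‖ = 1) (c : ℝ) {ε : ℝ} (hε : 0 < ε) (hε1 : ε ≤ 1) :
    ∃ δ > 0, ∀ t, 0 < t → t < δ → ∀ u v : E, ‖u‖ = 1 → ‖v‖ = 1 → ∀ r, 0 ≤ r →
      r * (1 - t * (⟪X v, e⟫_ℝ - c)) < 1 →
      r * ⟪X v, u⟫_ℝ < ⟪X u, u⟫_ℝ * (1 + (t * (⟪X u, e⟫_ℝ - c) + t ^ 2 *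
        ((⟪X u, e⟫_ℝ - c) ^ 2 + ⟪X u, u⟫_ℝ * ⟪fderiv ℝ X u e, e⟫_ℝ / 2 + ε))) := by
  obtain ⟨M, hM, hb⟩ := hX.exists_uniform_bound e c
  obtain ⟨δ, hδ, hT⟩ := hX.exists_quadratic_upper_bound (ε := ε / (8 * M)) (by positivity)
  have hN : 0 < 2 * M ^ 2 + 1 + M := by positivity
  have hN2 : 0 < M * (2 * M ^ 2 + 1) + 2 * M ^ 2 * (2 * M ^ 2 + 1 + M) := by positivity
  refine ⟨min (min (1 / (2 * (2 * M ^ 2 + 1 + M)))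
    (ε / 2 / (M * (2 * M ^ 2 + 1) + 2 * M ^ 2 * (2 * M ^ 2 + 1 + M))))
    (min (δ / (2 * M)) (1 / (4 * M))), by positivity, fun t ht htδ u v hu hv r hr hrt => ?_⟩
  have ht1 := (htδ.trans_le ((min_le_left _ _).trans (min_le_left _ _))).le
  have ht2 := (htδ.trans_le ((min_le_left _ _).trans (min_le_right _ _))).le
  have ht3 := (htδ.trans_le ((min_le_right _ _).trans (min_le_left _ _))).le
  have ht4 := (htδ.trans_le ((min_le_right _ _).trans (min_le_right _ _))).le
  rw [le_div_iff₀ (by positivity)] at ht1 ht2 ht3 ht4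
  have hu0 : u ≠ 0 := norm_ne_zero_iff.1 (by simp [hu])
  have hv0 : v ≠ 0 := norm_ne_zero_iff.1 (by simp [hv])
  obtain ⟨hhM, hφ, hD⟩ := hb u hu
  have hh := hX.inner_pos u hu0
  have hy := abs_radius_perturbation_le hε hε1 ht (by linarith) hM hh hhM hφ hD
  have hq := quadratic_radius_estimate hε hε1 ht (by linarith) ht2 hM hh hhM hφ hD
  set h := ⟪X u, u⟫_ℝ
  set D := ⟪fderiv ℝ X u e, e⟫_ℝ
  set y := t * (⟪X u, e⟫_ℝ - c) + t ^ 2 * ((⟪X u, e⟫_ℝ - c) ^ 2 + h * D / 2 + ε)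
  have hy' := abs_le.1 (hy.trans (by linarith : t * (2 * M ^ 2 + 1 + M) ≤ 1 / 2))
  set l := h * (1 + y)
  have hl : 0 < l := mul_pos hh (by linarith)
  have hl2 : l ≤ 2 * M := by
    calc h * (1 + y) ≤ M * 2 := by gcongr <;> linarith
      _ = 2 * M := by ring
  have hw : ‖(t * l) • e‖ = t * l := by
    rw [norm_smul, he, mul_one, Real.norm_of_nonneg (by positivity)]
  have htl : t * l ≤ t * (2 * M) := by gcongr
  have hT' := hT u ((t * l) • e) hu (by rw [hw]; linarith)
  have hne : u + (t * l) • e ≠ 0 := by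
    intro h0
    have := norm_add_le (u + (t * l) • e) (-((t * l) • e))
    rw [add_neg_cancel_right, hu, h0, norm_zero, norm_neg, hw] at this
    linarith
  have hle := (hX.inner_le _ v hne hv0).trans hT'
  rw [hw] at hle
  simp only [inner_add_right, inner_smul_right, map_smul, inner_smul_left,
    RCLike.conj_to_real] at hle
  change ⟪X v, u⟫_ℝ + t * l * ⟪X v, e⟫_ℝ ≤ h + t * l * ⟪X u, e⟫_ℝ + t * l * (t * l * D) / 2 +
    ε / (8 * M) * (t * l) ^ 2 at hle
  have h3 : ⟪X v, u⟫_ℝ ≤ l * (1 - t * (⟪X v, e⟫_ℝ - c)) := by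
    clear_value l y D h
    linarith
  calc r * ⟪X v, u⟫_ℝ ≤ r * (l * (1 - t * (⟪X v, e⟫_ℝ - c))) := by gcongr
    _ = l * (r * (1 - t * (⟪X v, e⟫_ℝ - c))) := by ring
    _ < l * 1 := by gcongr
    _ = l := mul_one l

theorem fderiv_support (hX : IsIsotropicInverseGaussMap X) {u : E} (hu : u ≠ 0) :
    fderiv ℝ (fun x => ⟪X x, x⟫_ℝ) u = innerSL ℝ (X u) := (hX.hasFDerivAt_support hu).fderiv

theorem support_smul (hX : IsIsotropicInverseGaussMap X) :
    ∀ c > (0 : ℝ), ∀ x, ⟪X (c • x), c • x⟫_ℝ = c * ⟪X x, x⟫_ℝ := fun c hc x => by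
  rw [hX.smul c hc, inner_smul_right]

theorem contDiffOn_support (hX : IsIsotropicInverseGaussMap X) :
    ContDiffOn ℝ 1 (fun x => ⟪X x, x⟫_ℝ) {0}ᶜ := hX.contDiffOn.inner ℝ contDiffOn_id

end IsIsotropicInverseGaussMap

/-! ### Brunn–Minkowski for images of star bodies and its second-order consequence -/

namespace IsIsotropicInverseGaussMap

variable {E : Type*} [NormedAddCommGroup E] [InnerProductSpace ℝ E] {X : E → E}
  [FiniteDimensional ℝ E] [MeasurableSpace E] [BorelSpace E] [Nontrivial E]

/-- The Brunn–Minkowski inequality for the images of star bodies under the volume preserving map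
`x ↦ ‖x‖ • X x`. -/
theorem sphereIntegral_mul_le_sq_of_midpoint (hX : IsIsotropicInverseGaussMap X)
    {R₁ R₂ R : E → ℝ} (hR₁ : ContinuousOn R₁ (sphere 0 1)) (hR₂ : ContinuousOn R₂ (sphere 0 1))
    (hR : ContinuousOn R (sphere 0 1)) (h₁ : ∀ u : E, ‖u‖ = 1 → 0 < R₁ u)
    (h₂ : ∀ u : E, ‖u‖ = 1 → 0 < R₂ u) (h₀ : ∀ u : E, ‖u‖ = 1 → 0 < R u)
    (H : ∀ u v w : E, ‖u‖ = 1 → ‖v‖ = 1 → ‖w‖ = 1 → ∀ r s, 0 < r → r < R₁ v → 0 < s → s < R₂ w →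
      (r * ⟪X v, u⟫_ℝ + s * ⟪X w, u⟫_ℝ) / 2 < R u * ⟪X u, u⟫_ℝ) :
    sphereIntegral (fun u => R₁ u ^ finrank ℝ E) * sphereIntegral (fun u => R₂ u ^ finrank ℝ E) ≤
      sphereIntegral (fun u => R u ^ finrank ℝ E) ^ 2 := by
  set Φ : E → E := fun x => ‖x‖ • X x
  have hsub : ∀ R : E → ℝ, puncturedStar R ⊆ {0}ᶜ := fun R x hx => hx.1
  have hm₁ := (isOpen_puncturedStar hR₁).measurableSet
  have hm₂ := (isOpen_puncturedStar hR₂).measurableSet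
  have hm := (isOpen_puncturedStar hR).measurableSet
  have hnorm : ∀ x : E, x ≠ 0 → ‖‖x‖⁻¹ • x‖ = 1 := fun x hx => by
    simp [norm_smul, norm_ne_zero_iff.2 hx]
  have hXn : ∀ x : E, x ≠ 0 → X (‖x‖⁻¹ • x) = X x := fun x hx =>
    hX.smul _ (inv_pos.2 (norm_pos_iff.2 hx)) x
  have hbm := brunnMinkowski_midpoint (hX.measurableSet_image_cone hm₁ (hsub R₁))
    (hX.measurableSet_image_cone hm₂ (hsub R₂))
    ((hX.measurableSet_image_cone hm (hsub R)).union (measurableSet_singleton 0)) (by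
      rintro _ ⟨x, ⟨hx0, hx⟩, rfl⟩ _ ⟨y, ⟨hy0, hy⟩, rfl⟩
      -- The images omit the origin, which can be a midpoint; adjoining it changes no volume.
      by_cases hmid : (1 / 2 : ℝ) • (Φ x + Φ y) = 0
      · exact Or.inr hmid
      -- Writing the midpoint as ‖z‖ X(z), the bound `H` is needed only in the direction u = z/‖z‖;
      -- there it compares ‖z‖ h(u) with R(u) h(u).
      obtain ⟨z, hz0, hz⟩ := hX.surj _ hmid
      refine Or.inl ⟨z, ⟨hz0, ?_⟩, hz⟩
      have h1 := H _ _ _ (hnorm z hz0) (hnorm x hx0) (hnorm y hy0) _ _ (norm_pos_iff.2 hx0) hx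
        (norm_pos_iff.2 hy0) hy
      have hpos := hX.inner_pos _ (norm_ne_zero_iff.1 ((hnorm z hz0).trans_ne one_ne_zero))
      have h2 : ‖z‖ * ⟪X z, ‖z‖⁻¹ • z⟫_ℝ = (‖x‖ * ⟪X x, ‖z‖⁻¹ • z⟫_ℝ +
          ‖y‖ * ⟪X y, ‖z‖⁻¹ • z⟫_ℝ) / 2 := by
        have := congrArg (fun w => ⟪w, ‖z‖⁻¹ • z⟫_ℝ) hz
        simp only [Φ, inner_smul_left, inner_add_left, RCLike.conj_to_real] at this
        rw [this]; ring
      rw [hXn x hx0, hXn y hy0, hXn z hz0, ← h2] at h1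
      rw [hXn z hz0] at hpos
      exact lt_of_mul_lt_mul_right h1 hpos.le)
  have hC : volume (Φ '' puncturedStar R ∪ {0}) ≤ volume (Φ '' puncturedStar R) :=
    (measure_union_le _ _).trans (by simp)
  have hbm' := hbm.trans (pow_le_pow_left' hC 2)
  rw [hX.volume_image_cone hm₁ (hsub _), hX.volume_image_cone hm₂ (hsub _),
    hX.volume_image_cone hm (hsub _), volume_puncturedStar hR₁ h₁, volume_puncturedStar hR₂ h₂,
    volume_puncturedStar hR h₀] at hbm'
  have hnn : ∀ R : E → ℝ, (∀ u : E, ‖u‖ = 1 → 0 < R u) →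
      0 ≤ sphereIntegral (fun u => R u ^ finrank ℝ E) := fun R hR =>
    integral_nonneg fun u => pow_nonneg (hR u (by simp)).le _
  have hd : (0 : ℝ) < finrank ℝ E := by exact_mod_cast Module.finrank_pos
  have e1 := hnn R₁ h₁
  have e2 := hnn R₂ h₂
  have e3 := hnn R h₀
  rw [← ENNReal.ofReal_mul (by positivity), ← ENNReal.ofReal_pow (by positivity),
    ENNReal.ofReal_le_ofReal_iff (by positivity), div_mul_div_comm, div_pow, ← sq] at hbm'
  exact (div_le_div_iff_of_pos_right (by positivity)).1 hbm'

theorem exists_sphereIntegral_mul_le_sq (hX : IsIsotropicInverseGaussMap X)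
    {e : E} (he : ‖e‖ = 1) (c : ℝ) {ε : ℝ} (hε : 0 < ε) (hε1 : ε ≤ 1) :
    ∃ δ > 0, ∀ t, 0 < t → t < δ →
      sphereIntegral (fun u => ((1 - t * (⟪X u, e⟫_ℝ - c))⁻¹) ^ finrank ℝ E) *
        sphereIntegral (fun u => ((1 - -(t * (⟪X u, e⟫_ℝ - c)))⁻¹) ^ finrank ℝ E) ≤
      sphereIntegral (fun u => (1 + t ^ 2 * ((⟪X u, e⟫_ℝ - c) ^ 2 +
        ⟪X u, u⟫_ℝ * ⟪fderiv ℝ X u e, e⟫_ℝ / 2 + ε)) ^ finrank ℝ E) ^ 2 := by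
  obtain ⟨M, hM, hb⟩ := hX.exists_uniform_bound e c
  obtain ⟨δ₁, hδ₁, H₁⟩ := hX.exists_support_bound_of_radial he c hε hε1
  -- Passing from (e, c) to (-e, -c) reverses the sign of φ and keeps the quadratic term, so the
  -- linear terms cancel when the two bounds are averaged.
  obtain ⟨δ₂, hδ₂, H₂⟩ := hX.exists_support_bound_of_radial (e := -e) (by simpa) (-c) hε hε1
  refine ⟨min (min δ₁ δ₂) (1 / (2 * M)), by positivity, fun t ht htδ => ?_⟩
  have ht1 := htδ.trans_le ((min_le_left _ _).trans (min_le_left _ _))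
  have ht2 := htδ.trans_le ((min_le_left _ _).trans (min_le_right _ _))
  have ht3 := htδ.trans_le (min_le_right _ _)
  rw [lt_div_iff₀ (by positivity)] at ht3
  have hφ : ∀ u : E, ‖u‖ = 1 → |t * (⟪X u, e⟫_ℝ - c)| ≤ 1 / 2 := by
    intro u hu
    rw [abs_mul, abs_of_pos ht]
    nlinarith [(hb u hu).2.1]
  have hp₁ : ∀ u : E, ‖u‖ = 1 → 0 < 1 - t * (⟪X u, e⟫_ℝ - c) := fun u hu => by
    linarith [(abs_le.1 (hφ u hu)).2]
  have hp₂ : ∀ u : E, ‖u‖ = 1 → 0 < 1 - -(t * (⟪X u, e⟫_ℝ - c)) := fun u hu => by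
    linarith [(abs_le.1 (hφ u hu)).1]
  have hc := (hX.continuousOn_inner e).sub (continuousOn_const (c := c))
  refine hX.sphereIntegral_mul_le_sq_of_midpoint
    ((continuousOn_const.sub (continuousOn_const.mul hc)).inv₀ fun u hu =>
      (hp₁ u (by simpa using hu)).ne')
    ((continuousOn_const.sub (continuousOn_const.mul hc).neg).inv₀ fun u hu =>
      (hp₂ u (by simpa using hu)).ne')
    (continuousOn_const.add (continuousOn_const.mul (((hc.pow 2).add
      ((hX.continuousOn_support.mul (hX.continuousOn_hessian e)).div_const 2)).add
      continuousOn_const)))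
    (fun u hu => inv_pos.2 (hp₁ u hu)) (fun u hu => inv_pos.2 (hp₂ u hu)) ?_ ?_
  · intro u hu
    have hu0 : u ≠ 0 := norm_ne_zero_iff.1 (by simp [hu])
    obtain ⟨h1, -, h3⟩ := hb u hu
    have h4 : |⟪X u, u⟫_ℝ * ⟪fderiv ℝ X u e, e⟫_ℝ| ≤ M ^ 2 := by
      rw [abs_mul, abs_of_pos (hX.inner_pos u hu0), sq]
      exact mul_le_mul h1 h3 (abs_nonneg _) (by linarith)
    have h5 := (abs_le.1 h4).1
    have h6 : t ^ 2 * M ^ 2 < 1 := by nlinarith [mul_pos ht (zero_lt_one.trans_le hM)]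
    have h7 : 0 ≤ t ^ 2 * (⟪X u, e⟫_ℝ - c) ^ 2 := by positivity
    have h8 : 0 < t ^ 2 * ε := by positivity
    have h9 : -(t ^ 2 * M ^ 2) ≤ t ^ 2 * (⟪X u, u⟫_ℝ * ⟪fderiv ℝ X u e, e⟫_ℝ) := by
      rw [← mul_neg]; gcongr
    linarith
  · intro u v w hu hv hw r s hr hrv hs hsw
    have a1 := H₁ t ht ht1 u v hu hv r hr.le (by
      rwa [lt_inv_comm₀ hr (hp₁ v hv), ← one_div, lt_div_iff₀ hr, mul_comm] at hrv)
    have a2 := H₂ t ht ht2 u w hu hw s hs.le (by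
      rw [lt_inv_comm₀ hs (hp₂ w hw), ← one_div, lt_div_iff₀ hs] at hsw
      simp only [inner_neg_right]
      linarith)
    simp only [inner_neg_right, map_neg, inner_neg_left, neg_neg] at a2
    linarith

end IsIsotropicInverseGaussMap

theorem exists_sphereIntegral_one_add_pow_le {E : Type*} [NormedAddCommGroup E]
    [InnerProductSpace ℝ E] [FiniteDimensional ℝ E] [MeasurableSpace E] [BorelSpace E]
    (d : ℕ) {Q : E → ℝ} (hQ : ContinuousOn Q (sphere 0 1)) :
    ∃ C : ℝ, ∃ δ > 0, ∀ t, 0 < t → t < δ →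
      0 ≤ sphereIntegral (fun u => (1 + t ^ 2 * Q u) ^ d) ∧
      sphereIntegral (fun u => (1 + t ^ 2 * Q u) ^ d) ≤
        sphereIntegral (fun _ : E => (1 : ℝ)) + d * t ^ 2 * sphereIntegral Q + C * t ^ 4 := by
  obtain ⟨B, hB⟩ := (isCompact_sphere (0 : E) 1).exists_bound_of_continuousOn hQ
  obtain ⟨C, hC, h⟩ := exists_one_add_pow_le d
  refine ⟨C * sphereIntegral (fun u => Q u ^ 2), min 1 (1 / (|B| + 1)), by positivity,
    fun t ht htδ => ?_⟩
  have ht1 := htδ.trans_le (min_le_left _ _)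
  have ht2 := htδ.trans_le (min_le_right _ _)
  rw [lt_div_iff₀ (by positivity)] at ht2
  have hb : ∀ u : E, ‖u‖ = 1 → |t ^ 2 * Q u| ≤ 1 := by
    intro u hu
    rw [abs_mul, abs_of_pos (pow_pos ht 2)]
    have hQu : |Q u| ≤ |B| := (hB u (by simpa using hu)).trans (le_abs_self B)
    calc t ^ 2 * |Q u| ≤ t ^ 2 * |B| := by gcongr
      _ ≤ t * (|B| + 1) := by nlinarith [abs_nonneg B]
      _ ≤ 1 := ht2.le
  constructor
  · refine integral_nonneg fun u => pow_nonneg ?_ _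
    linarith [(abs_le.1 (hb u (by simp))).1]
  calc sphereIntegral (fun u => (1 + t ^ 2 * Q u) ^ d)
      ≤ sphereIntegral (fun u => 1 + d * t ^ 2 * Q u + C * t ^ 4 * Q u ^ 2) := by
        refine sphereIntegral_mono (by fun_prop) (by fun_prop) fun u hu => ?_
        exact (h _ (hb u hu)).trans (by ring_nf; rfl)
    _ = _ := by
        rw [sphereIntegral_add (by fun_prop) (by fun_prop),
          sphereIntegral_add (by fun_prop) (by fun_prop), sphereIntegral_const_mul,
          sphereIntegral_const_mul]
        ring

/-- Integrated form of `exists_le_inv_one_sub_pow`; the term linear in t disappears because φ has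
mean zero. -/
theorem exists_le_sphereIntegral_inv_one_sub_pow {E : Type*} [NormedAddCommGroup E]
    [InnerProductSpace ℝ E] [FiniteDimensional ℝ E] [MeasurableSpace E] [BorelSpace E]
    (d : ℕ) {φ : E → ℝ} (hφ : ContinuousOn φ (sphere 0 1)) (hφ0 : sphereIntegral φ = 0) :
    ∃ C : ℝ, ∃ δ > 0, ∀ t, 0 < t → t < δ →
      sphereIntegral (fun _ : E => (1 : ℝ)) +
        d * (d + 1) / 2 * t ^ 2 * sphereIntegral (fun u => φ u ^ 2) - C * t ^ 3 ≤
      sphereIntegral (fun u => ((1 - t * φ u)⁻¹) ^ d) := by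
  obtain ⟨B, hB⟩ := (isCompact_sphere (0 : E) 1).exists_bound_of_continuousOn hφ
  obtain ⟨C, hC, h⟩ := exists_le_inv_one_sub_pow d
  refine ⟨C * sphereIntegral (fun u => |φ u| ^ 3), 1 / (2 * (|B| + 1)), by positivity,
    fun t ht htδ => ?_⟩
  rw [lt_div_iff₀ (by positivity)] at htδ
  have hb : ∀ u : E, ‖u‖ = 1 → |t * φ u| ≤ 1 / 2 := fun u hu => by
    rw [abs_mul, abs_of_pos ht]
    have hQu : |φ u| ≤ |B| := (hB u (by simpa using hu)).trans (le_abs_self B)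
    nlinarith
  have hφa : ContinuousOn (fun u => |φ u|) (sphere 0 1) := hφ.abs
  calc sphereIntegral (fun _ : E => (1 : ℝ)) +
        d * (d + 1) / 2 * t ^ 2 * sphereIntegral (fun u => φ u ^ 2) -
          C * sphereIntegral (fun u => |φ u| ^ 3) * t ^ 3
      = sphereIntegral (fun u => 1 + d * t * φ u + d * (d + 1) / 2 * t ^ 2 * φ u ^ 2 -
          C * t ^ 3 * |φ u| ^ 3) := by
        rw [sphereIntegral_sub (by fun_prop) (by fun_prop),
          sphereIntegral_add (by fun_prop) (by fun_prop),
          sphereIntegral_add (by fun_prop) (by fun_prop), sphereIntegral_const_mul,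
          sphereIntegral_const_mul, sphereIntegral_const_mul, hφ0]
        ring
    _ ≤ _ := by
        refine sphereIntegral_mono (by fun_prop) ?_ fun u hu => ?_
        · refine ContinuousOn.pow (ContinuousOn.inv₀ (by fun_prop) fun u hu => ?_) d
          have := (abs_le.1 (hb u (by simpa using hu))).2
          linarith
        · refine le_trans (le_of_eq ?_) (h _ (hb u hu))
          rw [abs_mul, abs_of_pos ht]
          ring

namespace IsIsotropicInverseGaussMap

variable {E : Type*} [NormedAddCommGroup E] [InnerProductSpace ℝ E] {X : E → E}
  [FiniteDimensional ℝ E] [MeasurableSpace E] [BorelSpace E] [Nontrivial E]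

/-- The local Brunn–Minkowski inequality for the coordinate functions of the hypersurface. -/
theorem local_brunnMinkowski (hX : IsIsotropicInverseGaussMap X) {e : E} (he : ‖e‖ = 1) (c : ℝ)
    (hc : sphereIntegral (fun u => ⟪X u, e⟫_ℝ - c) = 0) :
    (finrank ℝ E - 1) * sphereIntegral (fun u => (⟪X u, e⟫_ℝ - c) ^ 2) ≤
      sphereIntegral (fun u => ⟪X u, u⟫_ℝ * ⟪fderiv ℝ X u e, e⟫_ℝ) := by
  have hφc : ContinuousOn (fun u => ⟪X u, e⟫_ℝ - c) (sphere 0 1) :=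
    (hX.continuousOn_inner e).sub continuousOn_const
  have hψc := hX.continuousOn_support.mul (hX.continuousOn_hessian e)
  set S := sphereIntegral (fun u => (⟪X u, e⟫_ℝ - c) ^ 2)
  set q := sphereIntegral (fun u => ⟪X u, u⟫_ℝ * ⟪fderiv ℝ X u e, e⟫_ℝ)
  set m := sphereIntegral (fun _ : E => (1 : ℝ)) with hm
  have hm0 : 0 < m := sphereIntegral_one_pos
  have hd : (0 : ℝ) < finrank ℝ E := by exact_mod_cast Module.finrank_pos
  -- Here t tends to zero with ε fixed; ε tends to zero at the end. The t² coefficients give (d +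
  -- 1)S/2 ≤ S + q/2 + εm.
  have main : ∀ ε, 0 < ε → ε ≤ 1 → (finrank ℝ E - 1) * S ≤ q + 2 * ε * m := by
    intro ε hε hε1
    set Q : E → ℝ := fun u => (⟪X u, e⟫_ℝ - c) ^ 2 +
      ⟪X u, u⟫_ℝ * ⟪fderiv ℝ X u e, e⟫_ℝ / 2 + ε with hQ
    have hφ2 : ContinuousOn (fun u => (⟪X u, e⟫_ℝ - c) ^ 2) (sphere 0 1) := hφc.pow 2
    have hψ2 : ContinuousOn (fun u => ⟪X u, u⟫_ℝ * ⟪fderiv ℝ X u e, e⟫_ℝ / 2) (sphere 0 1) :=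
      hψc.div_const 2
    have hQc : ContinuousOn Q (sphere 0 1) := (hφ2.add hψ2).add continuousOn_const
    have hQi : sphereIntegral Q = S + q / 2 + ε * m := by
      rw [hQ, sphereIntegral_add (by fun_prop) continuousOn_const,
        sphereIntegral_add hφ2 hψ2, sphereIntegral_const]
      congr 2
      simpa [div_eq_inv_mul] using sphereIntegral_const_mul (1 / 2)
        (fun u => ⟪X u, u⟫_ℝ * ⟪fderiv ℝ X u e, e⟫_ℝ)
    obtain ⟨δ, hδ, hbm⟩ := hX.exists_sphereIntegral_mul_le_sq he c hε hε1
    obtain ⟨C₀, δ₀, hδ₀, h₀⟩ := exists_sphereIntegral_one_add_pow_le (finrank ℝ E) hQc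
    obtain ⟨C₁, δ₁, hδ₁, h₁⟩ := exists_le_sphereIntegral_inv_one_sub_pow (finrank ℝ E) hφc hc
    obtain ⟨C₂, δ₂, hδ₂, h₂⟩ := exists_le_sphereIntegral_inv_one_sub_pow (finrank ℝ E)
      (φ := fun u => -(⟪X u, e⟫_ℝ - c)) hφc.neg (by
        have := sphereIntegral_const_mul (-1) (fun u => ⟪X u, e⟫_ℝ - c)
        rw [hc, mul_zero] at this
        rw [← this]
        exact sphereIntegral_congr fun u _ => by ring)
    simp only [neg_sq, mul_neg] at h₂
    set C := max (max C₁ C₂) 0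
    have key : ∀ᶠ t in 𝓝[>] (0 : ℝ), (finrank ℝ E : ℝ) * (finrank ℝ E + 1) / 2 * S - C * t ≤
        finrank ℝ E * sphereIntegral Q + C₀ * t ^ 2 := by
      filter_upwards [Ioo_mem_nhdsGT (lt_min (lt_min hδ hδ₀) (lt_min hδ₁ hδ₂))] with t ht
      have ht0 := ht.1
      have b := hbm t ht0 (ht.2.trans_le ((min_le_left _ _).trans (min_le_left _ _)))
      obtain ⟨bn, b0⟩ := h₀ t ht0 (ht.2.trans_le ((min_le_left _ _).trans (min_le_right _ _)))
      have b1 := h₁ t ht0 (ht.2.trans_le ((min_le_right _ _).trans (min_le_left _ _)))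
      have b2 := h₂ t ht0 (ht.2.trans_le ((min_le_right _ _).trans (min_le_right _ _)))
      have c1 : C₁ * t ^ 3 ≤ C * t ^ 3 := by
        gcongr; exact (le_max_left _ _).trans (le_max_left _ _)
      have c2 : C₂ * t ^ 3 ≤ C * t ^ 3 := by
        gcongr; exact (le_max_right _ _).trans (le_max_left _ _)
      -- L bounds both integrals on the left of Brunn–Minkowski from below, so if L is positive a
      -- square root can be taken; otherwise the comparison is trivial.
      set L := m + finrank ℝ E * (finrank ℝ E + 1) / 2 * t ^ 2 * S - C * t ^ 3 with hL
      have hLU : L ≤ sphereIntegral (fun u => (1 + t ^ 2 * Q u) ^ finrank ℝ E) := by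
        rcases le_or_gt L 0 with hL0 | hL0
        · exact hL0.trans bn
        · refine (sq_le_sq₀ hL0.le bn).1 ?_
          refine le_trans ?_ b
          rw [sq]
          exact mul_le_mul (by linarith) (by linarith) hL0.le (by linarith)
      have hfin := hLU.trans b0
      have ht2 : 0 < t ^ 2 := by positivity
      refine le_of_mul_le_mul_left ?_ ht2
      rw [hL] at hfin
      linarith
    have lim := le_of_tendsto_of_tendsto (b := 𝓝[>] (0 : ℝ))
      (f := fun t => (finrank ℝ E : ℝ) * (finrank ℝ E + 1) / 2 * S - C * t)
      (g := fun t => finrank ℝ E * sphereIntegral Q + C₀ * t ^ 2)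
      (a₁ := (finrank ℝ E : ℝ) * (finrank ℝ E + 1) / 2 * S - C * 0)
      (a₂ := finrank ℝ E * sphereIntegral Q + C₀ * 0 ^ 2)
      ((Continuous.tendsto (by fun_prop) 0).mono_left nhdsWithin_le_nhds)
      ((Continuous.tendsto (by fun_prop) 0).mono_left nhdsWithin_le_nhds) key
    rw [hQi] at lim
    have lim' : (finrank ℝ E : ℝ) * ((finrank ℝ E + 1) / 2 * S) ≤
      finrank ℝ E * (S + q / 2 + ε * m) := by linarith
    have := le_of_mul_le_mul_left lim' hd
    linarith
  refine le_of_forall_pos_le_add fun η hη => ?_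
  have h1 := main (min 1 (η / (2 * m))) (by positivity) (min_le_left _ _)
  have h2 : 2 * min 1 (η / (2 * m)) * m ≤ η := by
    calc 2 * min 1 (η / (2 * m)) * m ≤ 2 * (η / (2 * m)) * m := by
          gcongr; exact min_le_right _ _
      _ = η := by field_simp
  linarith

theorem sphereIntegral_inner (hX : IsIsotropicInverseGaussMap X) (e : E) :
    sphereIntegral (fun u => ⟪X u, e⟫_ℝ) =
      finrank ℝ E * sphereIntegral (fun u => ⟪X u, u⟫_ℝ * ⟪u, e⟫_ℝ) := by
  rw [← sphereIntegral_fderiv hX.support_smul hX.contDiffOn_support]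
  exact sphereIntegral_congr fun u hu => by
    rw [hX.fderiv_support (norm_ne_zero_iff.1 (hu.trans_ne one_ne_zero))]; rfl

/-- Integration by parts for the degree-one function h⟪X, e⟫, whose derivative along e is ⟪X, e⟫² +
h⟪dX e, e⟫. -/
theorem sphereIntegral_hessian (hX : IsIsotropicInverseGaussMap X) (e : E) :
    sphereIntegral (fun u => ⟪X u, u⟫_ℝ * ⟪fderiv ℝ X u e, e⟫_ℝ) =
      finrank ℝ E * sphereIntegral (fun u => ⟪X u, u⟫_ℝ * (⟪X u, e⟫_ℝ * ⟪u, e⟫_ℝ)) -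
        sphereIntegral (fun u => ⟪X u, e⟫_ℝ ^ 2) := by
  have h := sphereIntegral_fderiv (g := fun x => ⟪X x, x⟫_ℝ * ⟪X x, e⟫_ℝ)
    (fun c hc x => by rw [hX.support_smul c hc, hX.smul c hc, mul_assoc])
    (hX.contDiffOn_support.mul (hX.contDiffOn.inner ℝ contDiffOn_const)) e
  simp only [mul_assoc] at h
  rw [← h]
  refine Eq.trans ?_ (sphereIntegral_sub (g := fun u => ⟪X u, e⟫_ℝ ^ 2) ?_
    ((hX.continuousOn_inner e).pow 2))
  · refine sphereIntegral_congr fun u hu => ?_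
    have hu0 : u ≠ 0 := norm_ne_zero_iff.1 (hu.trans_ne one_ne_zero)
    have h1 := (hX.hasFDerivAt_support hu0).mul
      ((hX.hasFDerivAt hu0).inner ℝ (hasFDerivAt_const e u))
    have h2 : fderiv ℝ (fun x => ⟪X x, x⟫_ℝ * ⟪X x, e⟫_ℝ) u = _ := h1.fderiv
    rw [h2]
    simp [fderivInnerCLM_apply]
    ring
  · have hc : ContDiffOn ℝ 1 (fun x => ⟪X x, x⟫_ℝ * ⟪X x, e⟫_ℝ) {0}ᶜ :=
      hX.contDiffOn_support.mul (hX.contDiffOn.inner ℝ contDiffOn_const)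
    exact ((hc.continuousOn_fderiv_of_isOpen isOpen_compl_singleton le_rfl).mono
      sphere_one_subset_compl_zero).clm_apply continuousOn_const

end IsIsotropicInverseGaussMap

/-! ### Rigidity: the hypersurface is the unit sphere -/

theorem finrank_mul_sphereIntegral_inner_sq {E : Type*} [NormedAddCommGroup E]
    [InnerProductSpace ℝ E] [FiniteDimensional ℝ E] [MeasurableSpace E] [BorelSpace E]
    [Nontrivial E] (a : E) :
    finrank ℝ E * sphereIntegral (fun u => ⟪a, u⟫_ℝ ^ 2) =
      ‖a‖ ^ 2 * sphereIntegral (fun _ : E => (1 : ℝ)) := by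
  have h := sphereIntegral_fderiv (g := fun x => ⟪a, x⟫_ℝ)
    (fun c _ x => by simp [inner_smul_right])
    (contDiff_const.inner ℝ contDiff_id).contDiffOn a
  have h2 : ∀ u : E, fderiv ℝ (fun x => ⟪a, x⟫_ℝ) u a = ‖a‖ ^ 2 := by
    intro u
    rw [fderiv_inner_apply ℝ (differentiableAt_const _) differentiableAt_fun_id]
    simp
  simp only [h2] at h
  rw [← sphereIntegral_const, h]
  congr 2 with u
  rw [real_inner_comm u a, sq]

namespace IsIsotropicInverseGaussMap

variable {E : Type*} [NormedAddCommGroup E] [InnerProductSpace ℝ E] {X : E → E}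
  [FiniteDimensional ℝ E] [MeasurableSpace E] [BorelSpace E] [Nontrivial E]

/-- Here a is the mean of X over the sphere, and the difference of the two sides is the component of
X u - a orthogonal to u. The local inequalities for the coordinates of X, summed, show that its
squared norm has integral at most zero. -/
theorem exists_eq_add_smul (hX : IsIsotropicInverseGaussMap X) :
    ∃ a : E, ∀ u : E, ‖u‖ = 1 → X u = a + (⟪X u, u⟫_ℝ - ⟪a, u⟫_ℝ) • u := by
  set b := stdOrthonormalBasis ℝ E
  set m := sphereIntegral (fun _ : E => (1 : ℝ)) with hm
  have hm0 : 0 < m := sphereIntegral_one_pos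
  set d : ℝ := (finrank ℝ E : ℝ) with hd
  have hd0 : 0 < d := by rw [hd]; exact_mod_cast Module.finrank_pos
  set A : Fin (finrank ℝ E) → ℝ := fun i => m⁻¹ * sphereIntegral (fun u => ⟪X u, b i⟫_ℝ)
  have hA : ∀ i, sphereIntegral (fun u => ⟪X u, b i⟫_ℝ) = m * A i := fun i => by
    simp only [A]; field_simp
  set a : E := ∑ i, A i • b i with ha
  have hnormsq : ∀ x : E, ‖x‖ ^ 2 = ∑ i, ⟪x, b i⟫_ℝ ^ 2 := fun x => by
    rw [← real_inner_self_eq_norm_sq, ← b.sum_inner_mul_inner]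
    exact Finset.sum_congr rfl fun i _ => by rw [real_inner_comm x (b i), sq]
  have hai : ∀ i, ⟪a, b i⟫_ℝ = A i := fun i => by
    rw [ha, sum_inner, Finset.sum_eq_single i]
    · simp [inner_smul_left]
    · intro j _ hji
      simp [inner_smul_left, b.inner_eq_zero hji]
    · simp
  have hna : ‖a‖ ^ 2 = ∑ i, A i ^ 2 := by rw [hnormsq]; simp only [hai]
  have hcX := hX.continuousOn_sphere
  have hcs := hX.continuousOn_support
  have hXa : sphereIntegral (fun u => ⟪X u, a⟫_ℝ) = m * ‖a‖ ^ 2 := by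
    have : ∀ u, ⟪X u, a⟫_ℝ = ∑ i, A i * ⟪X u, b i⟫_ℝ := fun u => by
      rw [ha, inner_sum]
      exact Finset.sum_congr rfl fun i _ => by rw [inner_smul_right]
    simp only [this]
    have hcA : ∀ i, ContinuousOn (fun u => A i * ⟪X u, b i⟫_ℝ) (sphere 0 1) := fun i =>
      continuousOn_const.mul (hX.continuousOn_inner _)
    rw [sphereIntegral_sum _ fun i _ => hcA i, hna, Finset.mul_sum]
    exact Finset.sum_congr rfl fun i _ => by rw [sphereIntegral_const_mul, hA]; ring
  have hi : ∀ i, (d - 1) * (sphereIntegral (fun u => ⟪X u, b i⟫_ℝ ^ 2) - m * A i ^ 2) ≤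
      d * sphereIntegral (fun u => ⟪X u, u⟫_ℝ * (⟪X u, b i⟫_ℝ * ⟪u, b i⟫_ℝ)) -
        sphereIntegral (fun u => ⟪X u, b i⟫_ℝ ^ 2) := by
    intro i
    have hci := hX.continuousOn_inner (b i)
    have h1 := hX.local_brunnMinkowski (b.orthonormal.1 i) (A i) (by
      rw [sphereIntegral_sub hci continuousOn_const, sphereIntegral_const, hA]; ring)
    rw [hX.sphereIntegral_hessian] at h1
    have h2 : sphereIntegral (fun u => (⟪X u, b i⟫_ℝ - A i) ^ 2) =
        sphereIntegral (fun u => ⟪X u, b i⟫_ℝ ^ 2) - m * A i ^ 2 := by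
      have h3 : ∀ u, (⟪X u, b i⟫_ℝ - A i) ^ 2 =
          ⟪X u, b i⟫_ℝ ^ 2 - 2 * A i * ⟪X u, b i⟫_ℝ + A i ^ 2 := fun u => by ring
      simp only [h3]
      rw [sphereIntegral_add (by fun_prop) (by fun_prop),
        sphereIntegral_sub (by fun_prop) (by fun_prop), sphereIntegral_const_mul,
        sphereIntegral_const, hA]
      ring
    rwa [h2] at h1
  have hsum := Finset.sum_le_sum fun i (_ : i ∈ Finset.univ) => hi i
  have hc₁ : ∀ i, ContinuousOn (fun u => ⟪X u, b i⟫_ℝ ^ 2) (sphere 0 1) := fun i =>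
    (hX.continuousOn_inner (b i)).pow 2
  have hc₂ : ∀ i, ContinuousOn (fun u => ⟪X u, u⟫_ℝ * (⟪X u, b i⟫_ℝ * ⟪u, b i⟫_ℝ))
      (sphere 0 1) := fun i =>
    hcs.mul ((hX.continuousOn_inner (b i)).mul (continuousOn_id.inner continuousOn_const))
  rw [← Finset.mul_sum, Finset.sum_sub_distrib, ← Finset.mul_sum, ← hna,
    Finset.sum_sub_distrib, ← Finset.mul_sum,
    ← sphereIntegral_sum _ fun i _ => hc₁ i, ← sphereIntegral_sum _ fun i _ => hc₂ i] at hsum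
  have hP : sphereIntegral (fun u => ∑ i, ⟪X u, b i⟫_ℝ ^ 2) =
      sphereIntegral (fun u => ‖X u‖ ^ 2) :=
    sphereIntegral_congr fun u _ => (hnormsq _).symm
  have hH : sphereIntegral (fun u => ∑ i, ⟪X u, u⟫_ℝ * (⟪X u, b i⟫_ℝ * ⟪u, b i⟫_ℝ)) =
      sphereIntegral (fun u => ⟪X u, u⟫_ℝ ^ 2) :=
    sphereIntegral_congr fun u _ => by
      rw [← Finset.mul_sum, sq, ← b.sum_inner_mul_inner (X u) u]
      congr 1
      exact Finset.sum_congr rfl fun i _ => by rw [real_inner_comm u (b i)]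
  -- Equivalently d ∫ (‖X‖² - h²) ≤ (d - 1) m ‖a‖².
  have hsum' : (d - 1) * (sphereIntegral (fun u => ‖X u‖ ^ 2) - m * ‖a‖ ^ 2) ≤
      d * sphereIntegral (fun u => ⟪X u, u⟫_ℝ ^ 2) - sphereIntegral (fun u => ‖X u‖ ^ 2) := by
    rw [← hP, ← hH]; exact hsum
  have hu2 := finrank_mul_sphereIntegral_inner_sq a
  have hha := hX.sphereIntegral_inner a
  rw [hXa] at hha
  refine ⟨a, fun u hu => ?_⟩
  have hexp : ∀ u : E, ‖u‖ = 1 → ‖X u - (a + (⟪X u, u⟫_ℝ - ⟪a, u⟫_ℝ) • u)‖ ^ 2 =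
      ‖X u‖ ^ 2 - ⟪X u, u⟫_ℝ ^ 2 + ‖a‖ ^ 2 - ⟪a, u⟫_ℝ ^ 2 - 2 * ⟪X u, a⟫_ℝ +
        2 * (⟪X u, u⟫_ℝ * ⟪u, a⟫_ℝ) := by
    intro u hu
    simp only [← real_inner_self_eq_norm_sq, inner_sub_left, inner_sub_right, inner_add_left,
      inner_add_right, inner_smul_left, inner_smul_right, RCLike.conj_to_real]
    rw [real_inner_self_eq_norm_sq u, hu, real_inner_comm (X u) u, real_inner_comm (X u) a,
      real_inner_comm u a]
    ring
  have hcXn : ContinuousOn (fun u => ‖X u‖ ^ 2) (sphere (0 : E) 1) := hcX.norm.pow 2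
  have hcs2 : ContinuousOn (fun u => ⟪X u, u⟫_ℝ ^ 2) (sphere (0 : E) 1) := hcs.pow 2
  have hca := hX.continuousOn_inner a
  have hcsa : ContinuousOn (fun u => ⟪X u, u⟫_ℝ * ⟪u, a⟫_ℝ) (sphere (0 : E) 1) :=
    hcs.mul (continuousOn_id.inner continuousOn_const)
  have hI : sphereIntegral (fun u => ‖X u - (a + (⟪X u, u⟫_ℝ - ⟪a, u⟫_ℝ) • u)‖ ^ 2) ≤ 0 := by
    rw [sphereIntegral_congr hexp, sphereIntegral_add (by fun_prop) (by fun_prop),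
      sphereIntegral_sub (by fun_prop) (by fun_prop),
      sphereIntegral_sub (by fun_prop) (by fun_prop),
      sphereIntegral_add (by fun_prop) (by fun_prop),
      sphereIntegral_sub (by fun_prop) (by fun_prop), sphereIntegral_const_mul,
      sphereIntegral_const_mul, sphereIntegral_const, hXa]
    -- Using d ∫ ⟪a, u⟫² = m‖a‖² = d ∫ h⟪u, a⟫, d times the integral equals d ∫ (‖X‖² - h²) - (d -
    -- 1) m ‖a‖².
    refine nonpos_of_mul_nonpos_right (a := d) ?_ hd0
    linarith
  have h0 := eq_zero_of_sphereIntegral_le_zero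
    (f := fun u => ‖X u - (a + (⟪X u, u⟫_ℝ - ⟪a, u⟫_ℝ) • u)‖ ^ 2)
    ((hcX.sub (continuousOn_const.add ((hcs.sub (by fun_prop)).smul continuousOn_id))).norm.pow 2)
    (fun u _ => by positivity) hI u hu
  exact sub_eq_zero.1 (norm_eq_zero.1 (pow_eq_zero_iff two_ne_zero |>.1 h0))

omit [MeasurableSpace E] [BorelSpace E] in
-- The hypothesis says that the tangential gradient of h - ⟪a, ·⟫ vanishes, so for d ≥ 2 this
-- function is a constant κ on the connected sphere. The determinant condition reads (⟪a, v⟫ + κ)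
-- κ^(d-1) = 1 for every unit v.
theorem eq_self_of_eq_add_smul (hX : IsIsotropicInverseGaussMap X) {a : E}
    (ha : ∀ u : E, ‖u‖ = 1 → X u = a + (⟪X u, u⟫_ℝ - ⟪a, u⟫_ℝ) • u) {u : E} (hu : ‖u‖ = 1) :
    X u = u := by
  have hne : ∀ {u : E}, ‖u‖ = 1 → u ≠ 0 := fun {u} hu =>
    norm_ne_zero_iff.1 (hu.trans_ne one_ne_zero)
  have hfr : ∀ {u : E}, ‖u‖ = 1 → finrank ℝ (ℝ ∙ u)ᗮ + 1 = finrank ℝ E := fun {u} hu => by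
    have := Submodule.finrank_add_finrank_orthogonal (ℝ ∙ u)
    rw [finrank_span_singleton (hne hu)] at this
    omega
  rcases Nat.lt_or_ge 1 (finrank ℝ E) with hd | hd
  · have hnorm : ∀ x : E, x ≠ 0 → ‖‖x‖⁻¹ • x‖ = 1 := fun x hx => by
      simp [norm_smul, norm_ne_zero_iff.2 hx]
    set k : E → ℝ := fun x => ‖x‖⁻¹ * (⟪X x, x⟫_ℝ - ⟪a, x⟫_ℝ) with hk
    have hXk : ∀ x, x ≠ 0 → X x = a + (k x * ‖x‖⁻¹) • x := by
      intro x hx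
      have hx' := norm_pos_iff.2 hx
      have h1 := ha _ (hnorm x hx)
      rw [hX.smul _ (inv_pos.2 hx'), smul_smul] at h1
      simp only [inner_smul_right, ← mul_sub] at h1
      exact h1
    have hder : ∀ x : E, x ≠ 0 → HasFDerivAt k (0 : E →L[ℝ] ℝ) x := by
      intro x hx
      have hx' := norm_pos_iff.2 hx
      have h1 := (hasDerivAt_inv hx'.ne').comp_hasFDerivAt x (hasFDerivAt_norm_of_ne_zero hx)
      have h2 := h1.mul ((hX.hasFDerivAt_support hx).sub (innerSL ℝ a).hasFDerivAt)
      refine h2.congr_fderiv (ContinuousLinearMap.ext fun v => ?_)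
      have h3 : ⟪X x, v⟫_ℝ = ⟪a, v⟫_ℝ + k x * ‖x‖⁻¹ * ⟪x, v⟫_ℝ := by
        conv_lhs => rw [hXk x hx]
        simp [inner_add_left, inner_smul_left]
      simp [h3, hk]
      field_simp
      ring
    have hconn : IsPreconnected ({0}ᶜ : Set E) :=
      (isConnected_compl_singleton_of_one_lt_rank (Module.lt_rank_of_lt_finrank hd) 0).isPreconnected
    have hconst : ∀ x, x ≠ 0 → k x = k u := fun x hx =>
      isOpen_compl_singleton.is_const_of_fderiv_eq_zero hconn
        (fun y hy => (hder y hy).differentiableAt.differentiableWithinAt)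
        (fun y hy => (hder y hy).fderiv) hx (hne hu)
    set κ := k u
    have hdet : ∀ v : E, ‖v‖ = 1 → (⟪a, v⟫_ℝ + κ) * κ ^ (finrank ℝ E - 1) = 1 := by
      intro v hv
      have hv0 := hne hv
      have h1 : HasFDerivAt (fun x : E => a + (κ * ‖x‖⁻¹) • x) _ v :=
        ((((hasDerivAt_inv (norm_ne_zero_iff.2 hv0)).comp_hasFDerivAt v
          (hasFDerivAt_norm_of_ne_zero hv0)).const_mul κ).smul
          (hasFDerivAt_id v)).const_add a
      have h2 : X =ᶠ[𝓝 v] fun x => a + (κ * ‖x‖⁻¹) • x := by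
        filter_upwards [isOpen_compl_singleton.mem_nhds hv0] with x hx
        rw [hXk x hx, hconst x hx]
      have h3 := hX.det v hv (κ • LinearMap.id) fun w => by
        have hw := Submodule.mem_orthogonal_singleton_iff_inner_right.1 w.2
        rw [h2.fderiv_eq, h1.fderiv]
        simp [hv, hw]
      rw [LinearMap.det_smul, LinearMap.det_id, mul_one,
        show finrank ℝ (ℝ ∙ v)ᗮ = finrank ℝ E - 1 from Nat.eq_sub_of_add_eq (hfr hv)] at h3
      rw [← h3, hXk v hv0, hconst v hv0]
      simp [inner_add_left, inner_smul_left, hv]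
    -- Subtract the determinant conditions at v and -v.
    have hau : ∀ v : E, ‖v‖ = 1 → ⟪a, v⟫_ℝ = 0 := by
      intro v hv
      have h1 := hdet v hv
      have h2 := hdet (-v) (by simpa)
      rw [inner_neg_right] at h2
      have h3 : κ ^ (finrank ℝ E - 1) ≠ 0 := right_ne_zero_of_mul (h1.trans_ne one_ne_zero)
      have h4 : ⟪a, v⟫_ℝ * κ ^ (finrank ℝ E - 1) = 0 := by linarith
      exact (mul_eq_zero.1 h4).resolve_right h3
    have ha0 : a = 0 := by
      by_contra h
      have := hau _ (hnorm a h)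
      rw [inner_smul_right, real_inner_self_eq_norm_sq] at this
      have h1 := norm_pos_iff.2 h
      field_simp at this
      exact h1.ne' (by simpa using this)
    have hκ : 0 < κ := by
      have := hX.inner_pos u (hne hu)
      simpa [κ, hk, hu, ha0] using this
    have h1 := hdet u hu
    rw [hau u hu, zero_add, ← pow_succ', pow_eq_one_iff_of_nonneg hκ.le (by omega)] at h1
    have h2 := hXk u (hne hu)
    rw [ha0, hu] at h2
    change X u = 0 + (κ * 1⁻¹) • u at h2
    simpa [h1] using h2
  -- In dimension one the sphere is disconnected, but the tangent space is zero, so the determinant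
  -- is one and h(u) = 1.
  · have hd1 : finrank ℝ E = 1 := le_antisymm hd Module.finrank_pos
    obtain ⟨T, hT⟩ := hX.exists_tangentMap (hne hu)
    have h1 := hX.det u hu T hT
    have h0 : finrank ℝ (ℝ ∙ u)ᗮ = 0 := by have := hfr hu; omega
    rw [LinearMap.det_eq_one_of_finrank_eq_zero h0, mul_one] at h1
    obtain ⟨c, hc⟩ := (finrank_eq_one_iff_of_nonzero' u (hne hu)).1 hd1 (X u)
    rw [← hc, inner_smul_left, real_inner_self_eq_norm_sq, hu] at h1
    have : c = 1 := by simpa using h1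
    rw [← hc, this, one_smul]

theorem eq_self (hX : IsIsotropicInverseGaussMap X) {u : E} (hu : ‖u‖ = 1) : X u = u := by
  obtain ⟨a, ha⟩ := hX.exists_eq_add_smul
  exact hX.eq_self_of_eq_add_smul ha hu

end IsIsotropicInverseGaussMap

/-! ### Regularity of the inverse Gauss map -/

namespace BoundsSmoothStrictlyConvexHypersurface

variable {E : Type*} [NormedAddCommGroup E] [InnerProductSpace ℝ E] {K : Set E}

theorem frontier_subset (hK : BoundsSmoothStrictlyConvexHypersurface K) : frontier K ⊆ K :=
  hK.isCompact.isClosed.frontier_subset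

theorem mem_frontier_of_isOuterUnitNormal {p v : E} (hp : p ∈ K) (hv : IsOuterUnitNormal K p v) :
    p ∈ frontier K := by
  refine ⟨subset_closure hp, fun hint => ?_⟩
  obtain ⟨r, hr, hball⟩ := Metric.isOpen_iff.1 isOpen_interior p hint
  have h1 : p + (r / 2) • v ∈ K := by
    refine interior_subset (hball ?_)
    rw [mem_ball, dist_eq_norm, add_sub_cancel_left, norm_smul, hv.1, mul_one,
      Real.norm_of_nonneg (by positivity)]
    linarith
  have h2 := hv.2 _ h1
  rw [add_sub_cancel_left, inner_smul_left, real_inner_self_eq_norm_sq, hv.1] at h2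
  simp only [RCLike.conj_to_real] at h2
  linarith

theorem inner_pos_of_isOuterUnitNormal (hK : BoundsSmoothStrictlyConvexHypersurface K) {p v : E}
    (hv : IsOuterUnitNormal K p v) : 0 < ⟪p, v⟫_ℝ := by
  obtain ⟨r, hr, hball⟩ := Metric.isOpen_iff.1 isOpen_interior 0 hK.zero_mem_interior
  have h1 : (r / 2) • v ∈ K := by
    refine interior_subset (hball ?_)
    rw [mem_ball_zero_iff, norm_smul, hv.1, mul_one, Real.norm_of_nonneg (by positivity)]
    linarith
  have h2 := hv.2 _ h1
  rw [inner_sub_left, inner_smul_left, real_inner_self_eq_norm_sq, hv.1] at h2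
  simp only [RCLike.conj_to_real] at h2
  linarith

variable [FiniteDimensional ℝ E]

theorem exists_isOuterUnitNormal (hK : BoundsSmoothStrictlyConvexHypersurface K) {p : E}
    (hp : p ∈ frontier K) : ∃ v, IsOuterUnitNormal K p v := by
  obtain ⟨f, hf⟩ := geometric_hahn_banach_open_point hK.convex.interior isOpen_interior hp.2
  set w := (InnerProductSpace.toDual ℝ E).symm f
  have hw : ∀ x, ⟪x, w⟫_ℝ = f x := fun x => by
    rw [real_inner_comm]; exact InnerProductSpace.toDual_symm_apply
  have hw0 : w ≠ 0 := by
    intro h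
    have h1 := hf 0 hK.zero_mem_interior
    rw [← hw p, h, inner_zero_right, map_zero] at h1
    exact lt_irrefl _ h1
  have hle : ∀ q ∈ K, f q ≤ f p := by
    intro q hq
    have h1 : q ∈ closure (interior K) := by
      rw [hK.convex.closure_interior_eq_closure_of_nonempty_interior ⟨0, hK.zero_mem_interior⟩]
      exact subset_closure hq
    exact closure_minimal (fun x hx => (hf x hx).le)
      (isClosed_le f.continuous continuous_const) h1
  refine ⟨‖w‖⁻¹ • w, by simp [norm_smul, hw0], fun q hq => ?_⟩
  rw [inner_smul_right, inner_sub_left, hw, hw]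
  have := hle q hq
  exact mul_nonpos_of_nonneg_of_nonpos (by positivity) (by linarith)

theorem isOuterUnitNormal_gaussMap (hK : BoundsSmoothStrictlyConvexHypersurface K) {p : E}
    (hp : p ∈ frontier K) : IsOuterUnitNormal K p (gaussMap K p) :=
  Classical.epsilon_spec (hK.exists_isOuterUnitNormal hp)

/-- Lagrange multipliers: on the level set of ρ, the functional ⟪·, v⟫ has a local maximum at p. -/
theorem exists_fderiv_eq_smul_of_isOuterUnitNormal (hK : BoundsSmoothStrictlyConvexHypersurface K)
    {U : Set E} {ρ : E → ℝ} (hU : IsOpen U) (hρ : ContDiffOn ℝ ∞ ρ U)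
    (hM : ∀ q ∈ U, q ∈ frontier K ↔ ρ q = 0) {p v : E} (hpU : p ∈ U) (hp : p ∈ frontier K)
    (hv : IsOuterUnitNormal K p v) : ∃ c : ℝ, fderiv ℝ ρ p = c • innerSL ℝ v := by
  have hstrict : HasStrictFDerivAt ρ (fderiv ℝ ρ p) p :=
    (hρ.contDiffAt (hU.mem_nhds hpU)).hasStrictFDerivAt (by simp)
  have hext : IsLocalExtrOn (innerSL ℝ v) {x | ρ x = ρ p} p := by
    refine Or.inr ?_
    filter_upwards [mem_nhdsWithin_of_mem_nhds (hU.mem_nhds hpU), self_mem_nhdsWithin] with q hq hq'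
    have h1 : q ∈ frontier K := (hM q hq).2 (by rw [hq', (hM p hpU).1 hp])
    have h2 := hv.2 q (hK.frontier_subset h1)
    simp only [innerSL_apply_apply]
    rw [inner_sub_left, real_inner_comm v q, real_inner_comm v p] at h2
    linarith
  obtain ⟨a, b, hab, h⟩ := hext.exists_multipliers_of_hasStrictFDerivAt_1d hstrict
    (innerSL ℝ v).hasStrictFDerivAt
  rcases eq_or_ne a 0 with rfl | ha
  · have hb : b ≠ 0 := fun hb => hab (by rw [hb]; rfl)
    have h1 := congrArg (fun L => L v) h
    have h2 : ‖v‖ = 1 := hv.1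
    simp [hb] at h1
    simp [h1] at h2
  · refine ⟨-(a⁻¹ * b), ?_⟩
    rw [add_eq_zero_iff_eq_neg] at h
    rw [neg_smul, mul_smul, ← smul_neg, ← h, smul_smul, inv_mul_cancel₀ ha, one_smul]

/-- Near a point of the hypersurface, the Gauss map has a smooth extension. -/
theorem exists_local_normal (hK : BoundsSmoothStrictlyConvexHypersurface K) {p : E}
    (hp : p ∈ frontier K) : ∃ (U : Set E) (ρ : E → ℝ) (N : E → E), IsOpen U ∧ p ∈ U ∧
      ContDiffOn ℝ ∞ ρ U ∧ ContDiffOn ℝ 1 N U ∧ (∀ q ∈ U, ‖N q‖ = 1) ∧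
      (∀ q ∈ U, q ∈ frontier K ↔ ρ q = 0) ∧
      (∀ q ∈ U, q ∈ frontier K → ∀ v, IsOuterUnitNormal K q v → v = N q) ∧
      ∃ c > (0 : ℝ), fderiv ℝ ρ p = c • innerSL ℝ (N p) := by
  obtain ⟨U₀, ρ₀, hU₀, hpU₀, hρ₀, hM₀, hd₀⟩ := hK.smooth p hp
  obtain ⟨v, hv⟩ := hK.exists_isOuterUnitNormal hp
  obtain ⟨c₀, hc₀⟩ := hK.exists_fderiv_eq_smul_of_isOuterUnitNormal hU₀ hρ₀ hM₀ hpU₀ hp hv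
  -- The sign of ρ is chosen so that dρ(p) p > 0. Outer normals satisfy ⟪q, v⟫ > 0, so wherever
  -- dρ(q) q > 0 on the hypersurface the gradient is a positive multiple of the outer normal.
  obtain ⟨ρ, hρ, hM, hpos⟩ : ∃ ρ : E → ℝ, ContDiffOn ℝ ∞ ρ U₀ ∧
      (∀ q ∈ U₀, q ∈ frontier K ↔ ρ q = 0) ∧ 0 < fderiv ℝ ρ p p := by
    have hpv := hK.inner_pos_of_isOuterUnitNormal hv
    rw [real_inner_comm] at hpv
    rcases lt_trichotomy c₀ 0 with h | h | h
    · refine ⟨-ρ₀, hρ₀.neg, fun q hq => by simp [hM₀ q hq], ?_⟩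
      rw [fderiv_neg, hc₀]
      simpa using mul_neg_of_neg_of_pos h hpv
    · exact absurd (by rw [hc₀, h, zero_smul]) hd₀
    · refine ⟨ρ₀, hρ₀, hM₀, ?_⟩
      rw [hc₀]
      simpa using mul_pos h hpv
  have hdρ : ContDiffOn ℝ 1 (fderiv ℝ ρ) U₀ := hρ.fderiv_of_isOpen hU₀ (by norm_cast)
  set U := U₀ ∩ (fun q => fderiv ℝ ρ q q) ⁻¹' Ioi 0
  have hU : IsOpen U := (hdρ.continuousOn.clm_apply continuousOn_id).isOpen_inter_preimage hU₀
    isOpen_Ioi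
  set G : E → E := fun q => (InnerProductSpace.toDual ℝ E).symm (fderiv ℝ ρ q)
  have hG : ContDiffOn ℝ 1 G U :=
    ((InnerProductSpace.toDual ℝ E).symm.toContinuousLinearEquiv.contDiff.comp_contDiffOn
      hdρ).mono inter_subset_left
  have hG0 : ∀ q ∈ U, G q ≠ 0 := by
    intro q hq h0
    have h1 : fderiv ℝ ρ q q = 0 := by
      rw [← InnerProductSpace.toDual_symm_apply (𝕜 := ℝ)]
      change ⟪G q, q⟫_ℝ = 0
      rw [h0, inner_zero_left]
    exact (ne_of_gt hq.2) h1
  have hcoef : ∀ q ∈ U, q ∈ frontier K → ∀ v, IsOuterUnitNormal K q v →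
      ∃ c > (0 : ℝ), fderiv ℝ ρ q = c • innerSL ℝ v ∧ v = ‖G q‖⁻¹ • G q := by
    intro q hq hqM v hv
    obtain ⟨c, hc⟩ := hK.exists_fderiv_eq_smul_of_isOuterUnitNormal hU₀ hρ hM hq.1 hqM hv
    have hqv := hK.inner_pos_of_isOuterUnitNormal hv
    have h1 : 0 < c * ⟪q, v⟫_ℝ := by
      have h2 : 0 < fderiv ℝ ρ q q := hq.2
      rw [hc] at h2
      simpa [real_inner_comm q v] using h2
    have hc0 : 0 < c := pos_of_mul_pos_left h1 hqv.le
    have hGv : G q = c • v := by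
      refine ext_inner_right ℝ fun w => ?_
      rw [InnerProductSpace.toDual_symm_apply, hc, inner_smul_left]
      rfl
    refine ⟨c, hc0, hc, ?_⟩
    rw [hGv, norm_smul, hv.1, mul_one, Real.norm_of_nonneg hc0.le, smul_smul,
      inv_mul_cancel₀ hc0.ne', one_smul]
  refine ⟨U, ρ, fun q => ‖G q‖⁻¹ • G q, hU, ⟨hpU₀, hpos⟩, hρ.mono inter_subset_left, ?_, ?_,
    fun q hq => hM q hq.1, ?_, ?_⟩
  · exact ((hG.norm ℝ hG0).inv fun q hq => norm_ne_zero_iff.2 (hG0 q hq)).smul hG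
  · intro q hq
    simp [norm_smul, hG0 q hq]
  · intro q hq hqM v hv
    obtain ⟨c, -, -, h⟩ := hcoef q hq hqM v hv
    exact h
  · obtain ⟨c, hc, h1, h2⟩ := hcoef p ⟨hpU₀, hpos⟩ hp v hv
    exact ⟨c, hc, by rw [h1, h2]⟩

theorem eq_gaussMap (hK : BoundsSmoothStrictlyConvexHypersurface K) {p v : E}
    (hp : p ∈ frontier K) (hv : IsOuterUnitNormal K p v) : v = gaussMap K p := by
  obtain ⟨U, ρ, N, -, hpU, -, -, -, -, hN, -⟩ := hK.exists_local_normal hp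
  rw [hN p hpU hp v hv, hN p hpU hp _ (hK.isOuterUnitNormal_gaussMap hp)]

/-- A derivative within M is not unique, but it is determined on tangent vectors: the implicit
function theorem gives a curve in M through p with velocity w, along which f and g agree. -/
theorem fderivWithin_eq_fderiv_of_eqOn {F : Type*} [NormedAddCommGroup F] [NormedSpace ℝ F]
    {M U : Set E} {ρ : E → ℝ} {f g : E → F} {p : E} (hU : IsOpen U) (hpU : p ∈ U)
    (hρ : ContDiffAt ℝ 1 ρ p) (hM : ∀ q ∈ U, q ∈ M ↔ ρ q = 0) (hp : p ∈ M)
    (hd : fderiv ℝ ρ p ≠ 0) (hg : DifferentiableAt ℝ g p) (hfg : ∀ q ∈ U, q ∈ M → f q = g q)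
    {w : E} (hw : fderiv ℝ ρ p w = 0) : fderivWithin ℝ f M p w = fderiv ℝ g p w := by
  have hev : f =ᶠ[𝓝[M] p] g := by
    filter_upwards [mem_nhdsWithin_of_mem_nhds (hU.mem_nhds hpU), self_mem_nhdsWithin] with q h1 h2
    exact hfg q h1 h2
  have hf : HasFDerivWithinAt f (fderivWithin ℝ f M p) M p :=
    (hg.hasFDerivAt.hasFDerivWithinAt.congr_of_eventuallyEq hev
      (hfg p hpU hp)).differentiableWithinAt.hasFDerivWithinAt
  have hρ' : HasStrictFDerivAt ρ (fderiv ℝ ρ p) p := hρ.hasStrictFDerivAt one_ne_zero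
  have hrange : (fderiv ℝ ρ p : E →ₗ[ℝ] ℝ).range = ⊤ :=
    LinearMap.range_eq_top.2 (LinearMap.surjective fun h => hd (by ext x; exact congrArg (· x) h))
  set γ : ℝ → E := fun s => hρ'.implicitFunction ρ (fderiv ℝ ρ p) hrange (ρ p) (s • ⟨w, hw⟩)
  have hγ0 : γ 0 = p := by
    simp only [γ, zero_smul]
    exact hρ'.implicitFunction_apply_image hrange
  have hγ : HasDerivAt γ w 0 := by
    have h1 : HasDerivAt (fun s : ℝ => s • (⟨w, hw⟩ : (fderiv ℝ ρ p : E →ₗ[ℝ] ℝ).ker))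
        ⟨w, hw⟩ 0 := by
      simpa using (hasDerivAt_id (0 : ℝ)).smul_const
        (⟨w, hw⟩ : (fderiv ℝ ρ p : E →ₗ[ℝ] ℝ).ker)
    have h2 := (hρ'.to_implicitFunction hrange).hasFDerivAt
    rw [← zero_smul ℝ (⟨w, hw⟩ : (fderiv ℝ ρ p : E →ₗ[ℝ] ℝ).ker)] at h2
    exact h2.comp_hasDerivAt 0 h1
  have hγU : ∀ᶠ s in 𝓝 (0 : ℝ), γ s ∈ U := by
    refine hγ.continuousAt.eventually_mem (hU.mem_nhds ?_)
    rwa [hγ0]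
  have hγM : ∀ᶠ s in 𝓝 (0 : ℝ), γ s ∈ M := by
    have h1 := hρ'.map_implicitFunction_eq hrange
    have h2 : Tendsto (fun s : ℝ => (ρ p, s • (⟨w, hw⟩ : (fderiv ℝ ρ p : E →ₗ[ℝ] ℝ).ker)))
        (𝓝 0) (𝓝 (ρ p, 0)) := by
      refine (Continuous.tendsto' (by fun_prop) _ _ ?_)
      simp
    filter_upwards [h2.eventually h1, hγU] with s hs hsU
    exact (hM _ hsU).2 (hs.trans ((hM p hpU).1 hp))
  have d1 : HasDerivAt (f ∘ γ) (fderivWithin ℝ f M p w) 0 :=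
    HasFDerivWithinAt.comp_hasDerivAt 0 (by rwa [hγ0]) hγ hγM
  have d2 : HasDerivAt (g ∘ γ) (fderiv ℝ g p w) 0 :=
    HasFDerivAt.comp_hasDerivAt 0 (by rw [hγ0]; exact hg.hasFDerivAt) hγ
  refine d1.unique (d2.congr_of_eventuallyEq ?_)
  filter_upwards [hγU, hγM] with s h1 h2
  exact hfg _ h1 h2

end BoundsSmoothStrictlyConvexHypersurface

/-! ### Inverting the Gauss map -/

namespace BoundsSmoothStrictlyConvexHypersurface

variable {E : Type*} [NormedAddCommGroup E] [InnerProductSpace ℝ E] {K : Set E}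

theorem exists_isOuterUnitNormal_of_norm_eq_one (hK : BoundsSmoothStrictlyConvexHypersurface K)
    {u : E} (hu : ‖u‖ = 1) : ∃ p ∈ frontier K, IsOuterUnitNormal K p u := by
  obtain ⟨p, hp, hmax⟩ := hK.isCompact.exists_isMaxOn ⟨0, interior_subset hK.zero_mem_interior⟩
    (f := fun q => ⟪q, u⟫_ℝ) (by fun_prop)
  have hn : IsOuterUnitNormal K p u := ⟨hu, fun q hq => by
    rw [inner_sub_left]; have := hmax hq; simp only [mem_ofPred_eq] at this; linarith⟩
  exact ⟨p, mem_frontier_of_isOuterUnitNormal hp hn, hn⟩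

theorem supportFunction_eq (hK : BoundsSmoothStrictlyConvexHypersurface K) {p u : E}
    (hp : p ∈ frontier K) (hn : IsOuterUnitNormal K p u) : supportFunction K u = ⟪p, u⟫_ℝ := by
  refine IsGreatest.csSup_eq ⟨⟨p, hK.frontier_subset hp, rfl⟩, ?_⟩
  rintro _ ⟨q, hq, rfl⟩
  have := hn.2 q hq
  rw [inner_sub_left] at this
  simp only
  linarith

variable [FiniteDimensional ℝ E]

/-- Along the hypersurface, the Gauss map is locally invertible, with an inverse of class `C^1`. -/
theorem exists_local_inverse_gaussMap (hK : BoundsSmoothStrictlyConvexHypersurface K) {p : E}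
    (hp : p ∈ frontier K) : DifferentiableWithinAt ℝ (gaussMap K) (frontier K) p ∧
      ∃ Y : E → E, ContDiffAt ℝ 1 Y (gaussMap K p) ∧
      (∀ᶠ u in 𝓝 (gaussMap K p), ‖u‖ = 1 → Y u ∈ frontier K ∧ IsOuterUnitNormal K (Y u) u) ∧
      ∀ᶠ q in 𝓝 p, q ∈ frontier K → IsOuterUnitNormal K q (gaussMap K p) → q = p := by
  obtain ⟨U, ρ, N, hU, hpU, hρ, hN, hN1, hM, hnormal, c, hc, hd⟩ := hK.exists_local_normal hp
  have hgN : ∀ q ∈ U, q ∈ frontier K → gaussMap K q = N q := fun q hq hqM =>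
    hnormal q hq hqM _ (hK.isOuterUnitNormal_gaussMap hqM)
  have hgp := hgN p hpU hp
  have hUp := hU.mem_nhds hpU
  have hρp : ContDiffAt ℝ 1 ρ p := (hρ.contDiffAt hUp).of_le (by norm_cast)
  have hNp : ContDiffAt ℝ 1 N p := hN.contDiffAt hUp
  have hρd := (hρp.differentiableAt one_ne_zero).hasFDerivAt
  have hNd := (hNp.differentiableAt one_ne_zero).hasFDerivAt
  have hρ0 : ρ p = 0 := (hM p hpU).1 hp
  have hNNp : ‖N p‖ = 1 := hN1 p hpU
  have hdne : fderiv ℝ ρ p ≠ 0 := by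
    intro h
    have h1 := congrArg (fun L => L (N p)) (hd.symm.trans h)
    simp [hNNp, hc.ne'] at h1
  refine ⟨hNd.differentiableAt.differentiableWithinAt.congr_of_eventuallyEq ?_ hgp, ?_⟩
  · filter_upwards [mem_nhdsWithin_of_mem_nhds hUp, self_mem_nhdsWithin] with q h1 h2
    exact hgN q h1 h2
  have horth : ∀ w, ⟪N p, fderiv ℝ N p w⟫_ℝ = 0 := by
    intro w
    have h1 := hNd.inner ℝ hNd
    have h2 : (fun q => ⟪N q, N q⟫_ℝ) =ᶠ[𝓝 p] fun _ => 1 := by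
      filter_upwards [hUp] with q hq
      rw [real_inner_self_eq_norm_sq, hN1 q hq, one_pow]
    have h3 := h1.unique ((hasFDerivAt_const (1 : ℝ) p).congr_of_eventuallyEq h2)
    have h4 := congrArg (fun L => L w) h3
    simp only [ContinuousLinearMap.comp_apply, fderivInnerCLM_apply,
      ContinuousLinearMap.prod_apply, _root_.zero_apply] at h4
    rw [real_inner_comm] at h4
    rw [real_inner_comm] at h4 ⊢
    linarith [real_inner_comm (N p) (fderiv ℝ N p w)]
  -- Ψ extends the Gauss map to a neighbourhood by storing ρ in the length: near p, ‖Ψ q‖ = 1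
  -- exactly on the hypersurface.
  set Ψ : E → E := fun q => (1 + ρ q) • N q
  have hΨ : ContDiffAt ℝ 1 Ψ p := (contDiffAt_const.add hρp).smul hNp
  have hΨp : Ψ p = gaussMap K p := by simp [Ψ, hρ0, hgp]
  set L : E →L[ℝ] E := fderiv ℝ N p + (fderiv ℝ ρ p).smulRight (N p) with hL
  have hΨd : HasFDerivAt Ψ L p := by
    have h1 := (hρd.const_add 1).smul hNd
    simp only [hρ0, add_zero, one_smul] at h1
    exact h1
  -- The images of dN are orthogonal to N, so a kernel vector is tangent and killed by the shape
  -- operator, which is invertible since the curvature is positive.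
  have hinj : Function.Injective (L : E →ₗ[ℝ] E) := by
    rw [← LinearMap.ker_eq_bot, LinearMap.ker_eq_bot']
    intro w hw
    have hw' : fderiv ℝ N p w + fderiv ℝ ρ p w • N p = 0 := hw
    have h1 : fderiv ℝ ρ p w = 0 := by
      have h2 := congrArg (fun x => ⟪N p, x⟫_ℝ) hw'
      simpa [inner_add_right, inner_smul_right, horth, hNNp] using h2
    rw [h1, zero_smul, add_zero] at hw'
    have hwN : w ∈ tangentHyperplane K p := by
      rw [tangentHyperplane, hgp, Submodule.mem_orthogonal_singleton_iff_inner_right]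
      rw [hd] at h1
      simpa [hc.ne'] using h1
    have h3 : fderivWithin ℝ (gaussMap K) (frontier K) p w = 0 := by
      rw [fderivWithin_eq_fderiv_of_eqOn hU hpU hρp hM hp hdne hNd.differentiableAt hgN h1, hw']
    have h4 : shapeOperator K p ⟨w, hwN⟩ = 0 := by
      simp [shapeOperator, h3]
    have h5 : LinearMap.det (shapeOperator K p : tangentHyperplane K p →ₗ[ℝ] _) ≠ 0 :=
      (hK.gaussCurvature_pos p hp).ne'
    have h6 : (⟨w, hwN⟩ : tangentHyperplane K p) = 0 :=
      (LinearMap.equivOfDetNeZero _ h5).injective (by rw [map_zero]; exact h4)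
    exact congrArg Subtype.val h6
  set e : E ≃L[ℝ] E := (LinearEquiv.ofInjectiveEndo (L : E →ₗ[ℝ] E) hinj).toContinuousLinearEquiv
  have hΨe : HasFDerivAt Ψ (e : E →L[ℝ] E) p := by
    convert hΨd using 1
    ext x
    rfl
  have hstrict : HasStrictFDerivAt Ψ (e : E →L[ℝ] E) p := hΨ.hasStrictFDerivAt' hΨe one_ne_zero
  set Y := hstrict.localInverse Ψ e p
  have hYc : ContDiffAt ℝ 1 Y (gaussMap K p) := hΨp ▸ hΨ.to_localInverse hΨe one_ne_zero
  have hYp : Y (gaussMap K p) = p := by rw [← hΨp]; exact hstrict.localInverse_apply_image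
  refine ⟨Y, hYc, ?_, ?_⟩
  · have h1 := hstrict.eventually_right_inverse
    rw [hΨp] at h1
    have h2 : ∀ᶠ u in 𝓝 (gaussMap K p), Y u ∈ U ∩ {q | 0 < 1 + ρ q} := by
      refine hYc.continuousAt.eventually_mem ?_
      rw [hYp]
      refine inter_mem hUp ?_
      exact (continuousAt_const.add hρp.continuousAt).eventually_const_lt (by simp [hρ0])
    filter_upwards [h1, h2] with u hu hu2 hu1
    have h3 : 1 + ρ (Y u) = 1 := by
      have h4 := congrArg norm hu
      simp only [Ψ] at h4
      rw [norm_smul, hN1 _ hu2.1, mul_one, Real.norm_of_nonneg (le_of_lt hu2.2), hu1] at h4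
      exact h4
    have h5 : Y u ∈ frontier K := (hM _ hu2.1).2 (by linarith)
    refine ⟨h5, ?_⟩
    have hu' : (1 + ρ (Y u)) • N (Y u) = u := hu
    have h6 : N (Y u) = u := by rwa [h3, one_smul] at hu'
    have h7 := hK.isOuterUnitNormal_gaussMap h5
    rwa [hgN _ hu2.1 h5, h6] at h7
  · filter_upwards [hstrict.eventually_left_inverse, hUp] with q hq hqU hqM hqn
    have h1 : Ψ q = gaussMap K p := by
      simp only [Ψ]
      rw [(hM q hqU).1 hqM, add_zero, one_smul, ← hnormal q hqU hqM _ hqn]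
    rw [← hq, h1]
    exact hYp

/-- The points with outer normal u form a convex set. By local injectivity of the Gauss map p is
isolated in it, which forces the segment from p to q to be trivial. -/
theorem eq_of_isOuterUnitNormal (hK : BoundsSmoothStrictlyConvexHypersurface K) {p q u : E}
    (hp : p ∈ frontier K) (hq : q ∈ frontier K) (hpu : IsOuterUnitNormal K p u)
    (hqu : IsOuterUnitNormal K q u) : p = q := by
  obtain ⟨-, Y, -, -, hiso⟩ := hK.exists_local_inverse_gaussMap hp
  rw [← hK.eq_gaussMap hp hpu] at hiso
  have hpK := hK.frontier_subset hp
  have hqK := hK.frontier_subset hq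
  have hpq : ⟪q - p, u⟫_ℝ = 0 := by
    have h1 := hpu.2 q hqK
    have h2 := hqu.2 p hpK
    rw [← neg_sub, inner_neg_left] at h2
    linarith
  have hcont : Tendsto (fun s : ℝ => p + s • (q - p)) (𝓝[>] 0) (𝓝 p) :=
    (Continuous.tendsto' (by fun_prop) 0 p (by simp)).mono_left nhdsWithin_le_nhds
  obtain ⟨s, hs, hs01⟩ := ((hcont.eventually hiso).and
    (Ioo_mem_nhdsGT (zero_lt_one (α := ℝ)))).exists
  have hsK : p + s • (q - p) ∈ K :=
    hK.convex.add_smul_sub_mem hpK hqK ⟨hs01.1.le, hs01.2.le⟩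
  have hsn : IsOuterUnitNormal K (p + s • (q - p)) u := by
    refine ⟨hpu.1, fun x hx => ?_⟩
    rw [← sub_sub, inner_sub_left, inner_smul_left, hpq]
    simpa using hpu.2 x hx
  have h1 := hs (mem_frontier_of_isOuterUnitNormal hsK hsn) hsn
  have h2 : s • (q - p) = 0 := by simpa using h1
  exact (sub_eq_zero.1 ((smul_eq_zero.1 h2).resolve_left hs01.1.ne')).symm

end BoundsSmoothStrictlyConvexHypersurface

/-- The inverse of the Gauss map of the boundary of `K`, extended to be homogeneous of degree
zero. -/
noncomputable def inverseGaussMap {E : Type*} [NormedAddCommGroup E] [InnerProductSpace ℝ E]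
    (K : Set E) (x : E) : E :=
  Classical.epsilon fun p => p ∈ frontier K ∧ IsOuterUnitNormal K p (‖x‖⁻¹ • x)

namespace BoundsSmoothStrictlyConvexHypersurface

variable {E : Type*} [NormedAddCommGroup E] [InnerProductSpace ℝ E] {K : Set E}

theorem inverseGaussMap_spec (hK : BoundsSmoothStrictlyConvexHypersurface K) {x : E}
    (hx : x ≠ 0) : inverseGaussMap K x ∈ frontier K ∧
      IsOuterUnitNormal K (inverseGaussMap K x) (‖x‖⁻¹ • x) :=
  Classical.epsilon_spec
    (p := fun p => p ∈ frontier K ∧ IsOuterUnitNormal K p (‖x‖⁻¹ • x))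
    (hK.exists_isOuterUnitNormal_of_norm_eq_one (by simp [norm_smul, hx]))

variable [FiniteDimensional ℝ E]

theorem inverseGaussMap_eq (hK : BoundsSmoothStrictlyConvexHypersurface K) {x p : E}
    (hx : x ≠ 0) (hp : p ∈ frontier K) (hn : IsOuterUnitNormal K p (‖x‖⁻¹ • x)) :
    inverseGaussMap K x = p :=
  hK.eq_of_isOuterUnitNormal (hK.inverseGaussMap_spec hx).1 hp (hK.inverseGaussMap_spec hx).2 hn

theorem gaussMap_inverseGaussMap (hK : BoundsSmoothStrictlyConvexHypersurface K) {x : E}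
    (hx : x ≠ 0) : gaussMap K (inverseGaussMap K x) = ‖x‖⁻¹ • x :=
  (hK.eq_gaussMap (hK.inverseGaussMap_spec hx).1 (hK.inverseGaussMap_spec hx).2).symm

theorem inverseGaussMap_gaussMap (hK : BoundsSmoothStrictlyConvexHypersurface K) {p : E}
    (hp : p ∈ frontier K) : inverseGaussMap K (gaussMap K p) = p := by
  have hn := hK.isOuterUnitNormal_gaussMap hp
  refine hK.inverseGaussMap_eq (norm_ne_zero_iff.1 (hn.1.trans_ne one_ne_zero)) hp ?_
  rwa [hn.1, inv_one, one_smul]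

theorem contDiffOn_inverseGaussMap (hK : BoundsSmoothStrictlyConvexHypersurface K) :
    ContDiffOn ℝ 1 (inverseGaussMap K) {0}ᶜ := by
  intro x hx
  refine ContDiffAt.contDiffWithinAt ?_
  have hx0 : x ≠ 0 := hx
  obtain ⟨-, Y, hY, hYn, -⟩ := hK.exists_local_inverse_gaussMap (hK.inverseGaussMap_spec hx0).1
  rw [hK.gaussMap_inverseGaussMap hx0] at hY hYn
  have hnorm : ContDiffAt ℝ 1 (fun x : E => ‖x‖⁻¹ • x) x :=
    ((contDiffAt_norm ℝ hx0).inv (norm_ne_zero_iff.2 hx0)).smul contDiffAt_id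
  refine (ContDiffAt.comp (f := fun x : E => ‖x‖⁻¹ • x) (g := Y) x hY hnorm).congr_of_eventuallyEq ?_
  filter_upwards [hnorm.continuousAt.eventually hYn, isOpen_compl_singleton.mem_nhds hx0]
    with y hy hy0
  have h1 := hy (by simp [norm_smul, norm_ne_zero_iff.2 hy0])
  exact hK.inverseGaussMap_eq hy0 h1.1 h1.2

/-- The Gauss map composed with its inverse is x ↦ x/‖x‖, whose differential at a unit vector is the
identity on the tangent space. The chain rule applies to `fderivWithin` because the inverse Gauss
map takes values in the boundary. -/
theorem gaussCurvature_mul_det (hK : BoundsSmoothStrictlyConvexHypersurface K) {p : E}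
    (hp : p ∈ frontier K) (T : (ℝ ∙ gaussMap K p)ᗮ →ₗ[ℝ] (ℝ ∙ gaussMap K p)ᗮ)
    (hT : ∀ v, (T v : E) = fderiv ℝ (inverseGaussMap K) (gaussMap K p) v) :
    gaussCurvature K p * LinearMap.det T = 1 := by
  have hn : ‖gaussMap K p‖ = 1 := (hK.isOuterUnitNormal_gaussMap hp).1
  have hu0 : gaussMap K p ≠ 0 := norm_ne_zero_iff.1 (hn.trans_ne one_ne_zero)
  have hXu : inverseGaussMap K (gaussMap K p) = p := hK.inverseGaussMap_gaussMap hp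
  have d1 : HasFDerivWithinAt (gaussMap K) (fderivWithin ℝ (gaussMap K) (frontier K) p)
      (frontier K) (inverseGaussMap K (gaussMap K p)) := by
    rw [hXu]
    exact (hK.exists_local_inverse_gaussMap hp).1.hasFDerivWithinAt
  have hnhds : ({0}ᶜ : Set E) ∈ 𝓝 (gaussMap K p) := isOpen_compl_singleton.mem_nhds hu0
  have d2 := ((hK.contDiffOn_inverseGaussMap.contDiffAt hnhds).differentiableAt
    one_ne_zero).hasFDerivAt
  have d3 := HasFDerivWithinAt.comp_hasFDerivAt (gaussMap K p) d1 d2 (by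
    filter_upwards [hnhds] with y hy using (hK.inverseGaussMap_spec hy).1)
  have d4 : HasFDerivAt (fun x : E => ‖x‖⁻¹ • x) _ (gaussMap K p) :=
    ((hasDerivAt_inv (norm_ne_zero_iff.2 hu0)).comp_hasFDerivAt (gaussMap K p)
      (hasFDerivAt_norm_of_ne_zero hu0)).smul (hasFDerivAt_id (gaussMap K p))
  have d5 := d3.unique (d4.congr_of_eventuallyEq (by
    filter_upwards [hnhds] with y hy using hK.gaussMap_inverseGaussMap hy))
  have hcomp : (shapeOperator K p : tangentHyperplane K p →ₗ[ℝ] tangentHyperplane K p) ∘ₗ T =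
      LinearMap.id := by
    ext v
    have hv := Submodule.mem_orthogonal_singleton_iff_inner_right.1 v.2
    have h1 := congrArg (fun L => L (v : E)) d5
    simp only [ContinuousLinearMap.comp_apply] at h1
    have h2 : fderivWithin ℝ (gaussMap K) (frontier K) p (T v) = v := by
      rw [hT]
      refine h1.trans ?_
      simp [hn, hv]
    simp [shapeOperator, h2]
  rw [gaussCurvature, ← LinearMap.det_comp, hcomp, LinearMap.det_id]

theorem isIsotropicInverseGaussMap (hK : BoundsSmoothStrictlyConvexHypersurface K)
    (hcurv : ∀ p ∈ frontier K, gaussCurvature K p = supportFunction K (gaussMap K p)) :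
    IsIsotropicInverseGaussMap (inverseGaussMap K) where
  contDiffOn := hK.contDiffOn_inverseGaussMap
  smul c hc x := by
    have : ‖c • x‖⁻¹ • c • x = ‖x‖⁻¹ • x := by
      rw [norm_smul, Real.norm_of_nonneg hc.le, smul_smul, mul_inv, mul_right_comm,
        inv_mul_cancel₀ hc.ne', one_mul]
    simp only [inverseGaussMap, this]
  inner_le u v hu hv := by
    have h1 := (hK.inverseGaussMap_spec hu).2.2 _
      (hK.frontier_subset (hK.inverseGaussMap_spec hv).1)
    rw [inner_smul_right, inner_sub_left] at h1
    have h2 := nonpos_of_mul_nonpos_right h1 (inv_pos.2 (norm_pos_iff.2 hu))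
    linarith
  inner_pos u hu := by
    have h1 := hK.inner_pos_of_isOuterUnitNormal (hK.inverseGaussMap_spec hu).2
    rw [inner_smul_right] at h1
    exact pos_of_mul_pos_right h1 (inv_nonneg.2 (norm_nonneg u))
  -- The preimage has length `gauge K y` and points along the outer normal at the radial projection
  -- of y to the boundary.
  surj y hy := by
    have hnhds : K ∈ 𝓝 (0 : E) := mem_interior_iff_mem_nhds.1 hK.zero_mem_interior
    have hg : 0 < gauge K y := (gauge_pos (absorbent_nhds_zero hnhds)
      ((NormedSpace.isVonNBounded_iff ℝ).2 hK.isCompact.isBounded)).2 hy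
    have hfr : (gauge K y)⁻¹ • y ∈ frontier K := by
      rw [← gauge_eq_one_iff_mem_frontier hK.convex hnhds,
        gauge_smul_of_nonneg (inv_nonneg.2 hg.le), smul_eq_mul, inv_mul_cancel₀ hg.ne']
    have hn := (hK.isOuterUnitNormal_gaussMap hfr).1
    set u := gaussMap K ((gauge K y)⁻¹ • y)
    have hu0 : u ≠ 0 := norm_ne_zero_iff.1 (hn.trans_ne one_ne_zero)
    refine ⟨gauge K y • u, smul_ne_zero hg.ne' hu0, ?_⟩
    have h1 : inverseGaussMap K (gauge K y • u) = (gauge K y)⁻¹ • y := by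
      refine hK.inverseGaussMap_eq (smul_ne_zero hg.ne' hu0) hfr ?_
      have : ‖gauge K y • u‖⁻¹ • gauge K y • u = u := by
        rw [norm_smul, hn, mul_one, Real.norm_of_nonneg hg.le, smul_smul, inv_mul_cancel₀ hg.ne',
          one_smul]
      rw [this]
      exact hK.isOuterUnitNormal_gaussMap hfr
    rw [h1, norm_smul, hn, mul_one, Real.norm_of_nonneg hg.le, smul_smul, mul_inv_cancel₀ hg.ne',
      one_smul]
  -- The gauge of ‖x‖ X(x) recovers ‖x‖, and the Gauss map at X(x) recovers the direction of x.
  injOn x hx y hy hxy := by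
    have hnhds : K ∈ 𝓝 (0 : E) := mem_interior_iff_mem_nhds.1 hK.zero_mem_interior
    have hga : ∀ x : E, x ≠ 0 → gauge K (‖x‖ • inverseGaussMap K x) = ‖x‖ := fun x hx => by
      rw [gauge_smul_of_nonneg (norm_nonneg _), (gauge_eq_one_iff_mem_frontier hK.convex hnhds).2
        (hK.inverseGaussMap_spec hx).1, smul_eq_mul, mul_one]
    have h1 : ‖x‖ = ‖y‖ := by rw [← hga x hx, ← hga y hy]; exact congrArg _ hxy
    have h2 : inverseGaussMap K x = inverseGaussMap K y := by
      simp only [h1] at hxy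
      exact smul_right_injective _ (norm_ne_zero_iff.2 hy) hxy
    have h3 := congrArg (gaussMap K) h2
    rw [hK.gaussMap_inverseGaussMap hx, hK.gaussMap_inverseGaussMap hy, h1] at h3
    exact smul_right_injective _ (inv_ne_zero (norm_ne_zero_iff.2 hy)) h3
  det u hu T hT := by
    have hu0 : u ≠ 0 := norm_ne_zero_iff.1 (hu.trans_ne one_ne_zero)
    obtain ⟨hp, hn⟩ := hK.inverseGaussMap_spec hu0
    have hg := hK.gaussMap_inverseGaussMap hu0
    rw [hu, inv_one, one_smul] at hg hn
    have h1 := hK.gaussCurvature_mul_det hp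
    rw [hcurv _ hp, hg, hK.supportFunction_eq hp hn] at h1
    exact h1 T hT

end BoundsSmoothStrictlyConvexHypersurface

theorem theorem1p1 (n : ℕ) (K : Set (EuclideanSpace ℝ (Fin (n + 1))))
    (hK : BoundsSmoothStrictlyConvexHypersurface K)
    (hcurv : ∀ p ∈ frontier K, gaussCurvature K p = supportFunction K (gaussMap K p)) :
    frontier K = Metric.sphere (0 : EuclideanSpace ℝ (Fin (n + 1))) 1 := by
  have hX := hK.isIsotropicInverseGaussMap hcurv
  ext p
  rw [mem_sphere_zero_iff_norm]
  constructor
  · intro hp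
    have hn := (hK.isOuterUnitNormal_gaussMap hp).1
    rw [← hK.inverseGaussMap_gaussMap hp, hX.eq_self hn, hn]
  · intro hp
    have h1 := (hK.inverseGaussMap_spec (norm_ne_zero_iff.1 (hp.trans_ne one_ne_zero))).1
    rwa [hX.eq_self hp] at h1
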